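/- Fix $Q\geqslant 1$ and put $L=\sqrt Q$. Let $I\subset\mathbb R$ be a bounded interval of positive length, let $\mathcal D(I)$ be the family of its dyadic subintervals (including $I$), and write $\langle w\rangle_J=\frac1{|J|}\int_J w$ and $\Delta_J w=\langle w\rangle_{J^-}-\langle w\rangle_{J^+}$, where $J^\pm$ are the two halves of $J$. A weight is a locally integrable function $w$ on $\mathbb R$ that is positive almost everywhere. Let $$\Omega_Q=\{(x_1,x_2):\ x_1,x_2>0,\ 1\leqslant x_1x_2\leqslant Q\}.$$ For $x=(x_1,x_2)\in\Omega_Q$ let $E_{Q,x,I}$ be the set of all weights $w$ such that $w^{-1}$ is integrable on $I$, $\langle w\rangle_J\langle w^{-1}\rangle_J\leqslant Q$ for all $J\in\mathcal D(I)$, $\langle w\rangle_I=x_1$ and $\langle w^{-1}\rangle_I=x_2$. For $\alpha\in\mathbb R$ let $$S_\alpha(w)=\frac1{|I|}\sum_{J\in\mathcal D(I)}|J|\,\big(\langle w\rangle_J\langle w^{-1}\rangle_J\big)^{\alpha}\left[\frac{(\Delta_J w)^2}{\langle w\rangle_J^2}+\frac{(\Delta_J w^{-1})^2}{\langle w^{-1}\rangle_J^2}\right],$$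 $$\mathbf B_{Q,\alpha}(x_1,x_2)=\sup\{S_\alpha(w):\ w\in E_{Q,x,I}\},\qquad \mathbf b_{Q,\alpha}(x_1,x_2)=\inf\{S_\alpha(w):\ w\in E_{Q,x,I}\}.$$ Then for every $(x_1,x_2)\in\Omega_Q$, with $s=\sqrt{x_1x_2}$, and for every such interval $I$, $$\mathbf B_{Q,\alpha}(x_1,x_2)=\begin{cases} \dfrac{8}{\alpha(2\alpha-1)}\big(1-s^{2\alpha}\big)+\dfrac{32\alpha}{2\alpha-1}L^{2\alpha-1}(s-1), & \alpha\in(0,\frac12)\cup(\frac12,1]\cup[\frac32,\infty),\\[2mm] 32(s-1)-16\log L+16\,s\log\big(\frac Ls\big), & \alpha=\frac12,\\[2mm] 16\log s, & \alpha=0,\\[2mm] \dfrac8\alpha\big(s^{2\alpha}-1\big), & \alpha<0; \end{cases}$$ $$\mathbf B_{Q,\alpha}(x_1,x_2)\leqslant\big[\mathbf B_{Q,1}(x_1,x_2)\big]^{3-2\alpha}\,\big[\mathbf B_{Q,3/2}(x_1,x_2)\big]^{2\alpha-2},\qquad \alpha\in(1,\tfrac32);$$ $$\mathbf b_{Q,\alpha}(x_1,x_2)=\frac8\alpha\big(s^{2\alpha}-1\big),\qquad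 \alpha\geqslant1;$$ $$\mathbf b_{Q,\alpha}(x_1,Q/x_1)=8\,L^{2\alpha-2}\big(L^2-1\big),\qquad \alpha<1.$$ -/

import Mathlib

open MeasureTheory Set
open scoped ENNReal

namespace CarlesonBellman

noncomputable section

/-- The `k`-th dyadic subinterval (`0 ≤ k < 2 ^ n`) of the `n`-th generation of the interval
`I = [a, b)`. The dyadic lattice `D(I)` consists of these intervals, for all `n` and `k < 2 ^ n`. -/
def dyadic (a b : ℝ) (n k : ℕ) : Set ℝ :=
  Ico (a + k * ((b - a) / 2 ^ n)) (a + (k + 1) * ((b - a) / 2 ^ n))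

/-- The average `⟨w⟩_J` of `w` over the dyadic interval `J = dyadic a b n k`. -/
def avg (a b : ℝ) (n k : ℕ) (w : ℝ → ℝ) : ℝ :=
  ⨍ t in dyadic a b n k, w t

/-- The difference `Δ_J w = ⟨w⟩_{J⁻} - ⟨w⟩_{J⁺}` of the averages of `w` over the left and the right
half of `J = dyadic a b n k`. -/
def delta (a b : ℝ) (n k : ℕ) (w : ℝ → ℝ) : ℝ :=
  avg a b (n + 1) (2 * k) w - avg a b (n + 1) (2 * k + 1) w

/-- A weight on the line: a locally integrable function that is positive almost everywhere. -/
def IsWeight (w : ℝ → ℝ) : Prop :=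
  LocallyIntegrable w ∧ ∀ᵐ t, 0 < w t

/-- `w` belongs to the dyadic Muckenhoupt class `A_2^{d,Q}(I)`, `I = [a, b)`: the averages of `w`
and of `w⁻¹` over the intervals `J` of `D(I)` are finite and
`sup_{J ∈ D(I)} ⟨w⟩_J ⟨w⁻¹⟩_J ≤ Q`. -/
def MemA2 (Q a b : ℝ) (w : ℝ → ℝ) : Prop :=
  IsWeight w ∧ IntegrableOn w⁻¹ (Ico a b) ∧
    ∀ n k : ℕ, k < 2 ^ n → avg a b n k w * avg a b n k w⁻¹ ≤ Q

/-- The domain `Ω_Q` in the open first quadrant, where pairs of averages of positive functions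
live. -/
def Omega (Q : ℝ) : Set (ℝ × ℝ) :=
  {x | 0 < x.1 ∧ 0 < x.2 ∧ 1 ≤ x.1 * x.2 ∧ x.1 * x.2 ≤ Q}

/-- The set `E_{Q,x,I}`, `I = [a, b)`, of the weights in `A_2^{d,Q}(I)` with `⟨w⟩_I = x₁` and
`⟨w⁻¹⟩_I = x₂`. -/
def weights (Q a b : ℝ) (x : ℝ × ℝ) : Set (ℝ → ℝ) :=
  {w | MemA2 Q a b w ∧ (⨍ t in Ico a b, w t) = x.1 ∧ (⨍ t in Ico a b, w⁻¹ t) = x.2}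

/-- The number `c_J^Φ(w) = |J| Φ(⟨w⟩_J ⟨w⁻¹⟩_J) [(Δ_J w)² / ⟨w⟩_J² + (Δ_J w⁻¹)² / ⟨w⁻¹⟩_J²]`
for `J = dyadic a b n k`. -/
def coeff (Φ : ℝ → ℝ) (a b : ℝ) (n k : ℕ) (w : ℝ → ℝ) : ℝ :=
  volume.real (dyadic a b n k) * Φ (avg a b n k w * avg a b n k w⁻¹) *
    ((delta a b n k w) ^ 2 / (avg a b n k w) ^ 2 +
      (delta a b n k w⁻¹) ^ 2 / (avg a b n k w⁻¹) ^ 2)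

/-- The sum `|I|⁻¹ ∑_{J ∈ D(I)} c_J^Φ(w)`, `I = [a, b)`, of non-negative terms, in `[0, ∞]`. -/
def dyadicSum (Φ : ℝ → ℝ) (a b : ℝ) (w : ℝ → ℝ) : ℝ≥0∞ :=
  (volume (Ico a b))⁻¹ *
    ∑' n : ℕ, ∑ k ∈ Finset.range (2 ^ n), ENNReal.ofReal (coeff Φ a b n k w)

/-- The upper Bellman function `B_{Q,Φ}(x)`, computed on the interval `I = [a, b)`. -/
def upperBellman (Q : ℝ) (Φ : ℝ → ℝ) (a b : ℝ) (x : ℝ × ℝ) : ℝ≥0∞ :=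
  ⨆ w ∈ weights Q a b x, dyadicSum Φ a b w

/-- The lower Bellman function `b_{Q,Φ}(x)`, computed on the interval `I = [a, b)`. -/
def lowerBellman (Q : ℝ) (Φ : ℝ → ℝ) (a b : ℝ) (x : ℝ × ℝ) : ℝ≥0∞ :=
  ⨅ w ∈ weights Q a b x, dyadicSum Φ a b w

/-- `B_{Q,α}`, for the power function `Φ(t) = t ^ α`. -/
def upperBellmanPow (Q α a b : ℝ) (x : ℝ × ℝ) : ℝ≥0∞ :=
  upperBellman Q (fun t => t ^ α) a b x

/-- `b_{Q,α}`, for the power function `Φ(t) = t ^ α`. -/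
def lowerBellmanPow (Q α a b : ℝ) (x : ℝ × ℝ) : ℝ≥0∞ :=
  lowerBellman Q (fun t => t ^ α) a b x

end

end CarlesonBellman

namespace CarlesonBellman

open Filter Topology

/-! Everything depends only on the product `u = x₁ x₂`, which lies in `[1, Q]`. Splitting an
interval moves `(x₁, x₂)` to `(x₁ (1 ± t₁), x₂ (1 ± t₂))` and contributes `4 Φ(u) (t₁² + t₂²)`.

Bounds for all weights come from Bellman induction. A nonnegative `g` satisfying `MainInequality`
dominates every dyadic sum. If instead `-g` satisfies it for `-Φ` and `g 1 = 0`, then `g` minorizes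
every dyadic sum: the remainder after `N` generations tends to zero, because `⟨w⟩_J ⟨w⁻¹⟩_J → 1`
almost everywhere (`MemA2.tendsto_sum_avgProd`).

Sharpness comes from gluing weights (`exists_concat`, `Attains.split`). Two kinds of splitting
matter. With `t₂ = -t₁` both children lie on one lower hyperbola, and many small such steps yield
`∫₁ᵘ 8 Φ(v) / v dv`, which is `8 / α * (u ^ α - 1)` for powers and `8 log u` for `α = 0`. This is
the upper function for `α ≤ 0` and the lower one for `α ≥ 1`. With `t₁ = t₂` the point moves along a
ray; in the variable `s = √u` the supremum `G` of attained values satisfies `G'' ≤ -16 κ`, `κ(s) =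
Φ(s²) / s²`, in a discrete sense. On the upper boundary `s = L` such a splitting would leave the
domain, and the first kind gives `G'(L) ≥ 16 L κ(L)`. The solution of `g'' = -16 κ`, `g 1 = 0`, `g'
L = 16 L κ(L)` is therefore a lower bound for `G` (`le_of_second_order`), and it is the stated
formula for `α > 0`.

It remains to verify `MainInequality` for these candidates. For the second-order ones, the
coordinates of `mainInequality_of_sqrt` reduce it to one-variable calculus (`core_le_two`,
`core_mul_log`, `core_three_le`). The argument uses convexity of `x ^ (2α - 2)`, which fails for `1
< α < 3/2`; there Hölder's inequality interpolates between `α = 1` and `α = 3/2`. For `α < 1` on the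
upper boundary, the lower function follows from `u ^ α ≥ Q ^ (α - 1) u` and the case `α = 1`, and
one splitting into two constants attains it. -/

/-! ### Dyadic intervals and averages. -/

theorem volume_dyadic (a b : ℝ) (n k : ℕ) :
    volume (dyadic a b n k) = ENNReal.ofReal ((b - a) / 2 ^ n) := by
  rw [dyadic, Real.volume_Ico]
  congr 1
  ring

theorem volume_real_dyadic {a b : ℝ} (hab : a < b) (n k : ℕ) :
    volume.real (dyadic a b n k) = (b - a) / 2 ^ n := by
  rw [measureReal_def, volume_dyadic, ENNReal.toReal_ofReal]
  have := sub_pos.2 hab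
  positivity

theorem dyadic_zero (a b : ℝ) : dyadic a b 0 0 = Ico a b := by
  simp [dyadic]

theorem measurableSet_dyadic (a b : ℝ) (n k : ℕ) : MeasurableSet (dyadic a b n k) :=
  measurableSet_Ico

theorem dyadic_subset {a b : ℝ} (hab : a < b) {n k : ℕ} (hk : k < 2 ^ n) :
    dyadic a b n k ⊆ Ico a b := by
  have hd : 0 < (b - a) / 2 ^ n := by have := sub_pos.2 hab; positivity
  have hk' : (k : ℝ) + 1 ≤ 2 ^ n := by exact_mod_cast hk
  apply Ico_subset_Ico
  · have : 0 ≤ (k : ℝ) * ((b - a) / 2 ^ n) := by positivity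
    linarith
  · have h1 : ((k : ℝ) + 1) * ((b - a) / 2 ^ n) ≤ 2 ^ n * ((b - a) / 2 ^ n) := by gcongr
    have h2 : (2 : ℝ) ^ n * ((b - a) / 2 ^ n) = b - a := by field_simp
    linarith

theorem dyadic_eq_union {a b : ℝ} (hab : a < b) (n k : ℕ) :
    dyadic a b n k = dyadic a b (n + 1) (2 * k) ∪ dyadic a b (n + 1) (2 * k + 1) := by
  have hd : 0 < (b - a) / 2 ^ (n + 1) := by have := sub_pos.2 hab; positivity
  have h : (b - a) / 2 ^ n = 2 * ((b - a) / 2 ^ (n + 1)) := by rw [pow_succ]; field_simp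
  unfold dyadic
  rw [h]
  push_cast
  rw [Ico_union_Ico_eq_Ico (by nlinarith) (by nlinarith)]
  congr 1 <;> ring

theorem disjoint_dyadic_children (a b : ℝ) (n k : ℕ) :
    Disjoint (dyadic a b (n + 1) (2 * k)) (dyadic a b (n + 1) (2 * k + 1)) := by
  unfold dyadic
  push_cast
  exact Ico_disjoint_Ico_same

theorem avg_eq {a b : ℝ} (hab : a < b) (n k : ℕ) (w : ℝ → ℝ) :
    avg a b n k w = ((b - a) / 2 ^ n)⁻¹ * ∫ t in dyadic a b n k, w t := by
  rw [avg, setAverage_eq, volume_real_dyadic hab, smul_eq_mul]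

theorem avg_eq_half {a b : ℝ} (hab : a < b) {n k : ℕ} (hk : k < 2 ^ n) {w : ℝ → ℝ}
    (hw : IntegrableOn w (Ico a b)) :
    avg a b n k w = (avg a b (n + 1) (2 * k) w + avg a b (n + 1) (2 * k + 1) w) / 2 := by
  have hw' := hw.mono_set (dyadic_subset hab hk)
  rw [dyadic_eq_union hab] at hw'
  rw [avg_eq hab, avg_eq hab, avg_eq hab, dyadic_eq_union hab,
    setIntegral_union (disjoint_dyadic_children a b n k) (measurableSet_dyadic _ _ _ _)
      hw'.left_of_union hw'.right_of_union, pow_succ]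
  have := (sub_pos.2 hab).ne'
  field_simp

theorem avg_zero_zero (a b : ℝ) (w : ℝ → ℝ) : avg a b 0 0 w = ⨍ t in Ico a b, w t := by
  rw [avg, dyadic_zero]

theorem IsWeight.integrableOn {w : ℝ → ℝ} (hw : IsWeight w) (a b : ℝ) :
    IntegrableOn w (Ico a b) :=
  (hw.1.integrableOn_isCompact isCompact_Icc).mono_set Ico_subset_Icc_self

theorem avg_pos {a b : ℝ} (hab : a < b) {n k : ℕ} (hk : k < 2 ^ n) {w : ℝ → ℝ}
    (hw : IntegrableOn w (Ico a b)) (hpos : ∀ᵐ t, 0 < w t) : 0 < avg a b n k w := by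
  have hd : 0 < (b - a) / 2 ^ n := by have := sub_pos.2 hab; positivity
  rw [avg_eq hab]
  apply mul_pos (inv_pos.2 hd)
  rw [integral_pos_iff_support_of_nonneg_ae
    ((ae_restrict_of_ae hpos).mono fun t ht => le_of_lt ht)
    (hw.mono_set (dyadic_subset hab hk))]
  have h1 : volume.restrict (dyadic a b n k) (Function.support w) =
      volume.restrict (dyadic a b n k) univ := by
    apply measure_congr
    filter_upwards [ae_restrict_of_ae hpos] with t ht
    exact propext ⟨fun _ => trivial, fun _ => ht.ne'⟩
  rw [h1, Measure.restrict_apply_univ, volume_dyadic]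
  simpa using hd

theorem one_le_avg_mul_avg_inv {a b : ℝ} (hab : a < b) {n k : ℕ} (hk : k < 2 ^ n) {w : ℝ → ℝ}
    (hw : IntegrableOn w (Ico a b)) (hwi : IntegrableOn w⁻¹ (Ico a b))
    (hpos : ∀ᵐ t, 0 < w t) : 1 ≤ avg a b n k w * avg a b n k w⁻¹ := by
  have hd : 0 < (b - a) / 2 ^ n := by have := sub_pos.2 hab; positivity
  have hA := avg_pos hab hk hw hpos
  set A := avg a b n k w with hAdef
  set B := avg a b n k w⁻¹ with hBdef
  have h1 := hw.mono_set (dyadic_subset hab hk)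
  have h2 := hwi.mono_set (dyadic_subset hab hk)
  -- Integrating `(w - A)² / w ≥ 0` avoids an appeal to the Cauchy–Schwarz inequality.
  have h3 : ∫ t in dyadic a b n k, (2 * A) ≤
      ∫ t in dyadic a b n k, (w t + A ^ 2 * w⁻¹ t) := by
    apply integral_mono_ae
    · apply integrable_const_iff.2
      right
      rw [isFiniteMeasure_iff, Measure.restrict_apply_univ, volume_dyadic]
      exact ENNReal.ofReal_lt_top
    · exact h1.add (h2.const_mul _)
    · filter_upwards [ae_restrict_of_ae hpos] with t ht
      have : w t + A ^ 2 * (w t)⁻¹ - 2 * A = (w t - A) ^ 2 * (w t)⁻¹ := by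
        field_simp; ring
      have : 0 ≤ (w t - A) ^ 2 * (w t)⁻¹ := by positivity
      simp only [Pi.inv_apply]
      linarith
  rw [integral_add h1 (h2.const_mul _), setIntegral_const, volume_real_dyadic hab, smul_eq_mul,
    integral_const_mul (A ^ 2) w⁻¹] at h3
  have e1 : ∫ t in dyadic a b n k, w t = ((b - a) / 2 ^ n) * A := by
    rw [hAdef, avg_eq hab, mul_inv_cancel_left₀ hd.ne']
  have e2 : ∫ t in dyadic a b n k, w⁻¹ t = ((b - a) / 2 ^ n) * B := by
    rw [hBdef, avg_eq hab, mul_inv_cancel_left₀ hd.ne']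
  rw [e1, e2] at h3
  have h4 : 2 * A ≤ A + A ^ 2 * B := by
    apply le_of_mul_le_mul_left _ hd
    linarith
  have h5 : A * 1 ≤ A * (A * B) := by nlinarith
  exact le_of_mul_le_mul_left h5 hA

/-! ### Bellman induction and upper bounds for dyadic sums. -/

theorem sum_range_two_mul {M : Type*} [AddCommMonoid M] (f : ℕ → M) (m : ℕ) :
    ∑ k ∈ Finset.range (2 * m), f k = ∑ k ∈ Finset.range m, (f (2 * k) + f (2 * k + 1)) := by
  induction m with
  | zero => simp
  | succ m ih =>
    rw [Finset.sum_range_succ, ← ih, mul_add, Finset.sum_range_succ, Finset.sum_range_succ,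
      add_assoc]

/-- The inequality `g(x₁ x₂) ≥ (g(x₁⁻ x₂⁻) + g(x₁⁺ x₂⁺)) / 2 + ⋯` for all dyadic splittings
of a point of `Ω_Q`, expressed through the product `u = x₁ x₂`. -/
def MainInequality (Q : ℝ) (Φ g : ℝ → ℝ) : Prop :=
  ∀ u t₁ t₂ : ℝ, 1 ≤ u → u ≤ Q → |t₁| < 1 → |t₂| < 1 →
    u * ((1 + t₁) * (1 + t₂)) ∈ Icc 1 Q → u * ((1 - t₁) * (1 - t₂)) ∈ Icc 1 Q →
    (g (u * ((1 + t₁) * (1 + t₂))) + g (u * ((1 - t₁) * (1 - t₂)))) / 2 +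
      4 * Φ u * (t₁ ^ 2 + t₂ ^ 2) ≤ g u

/-- The product of the averages of `w` and `w⁻¹` over a dyadic interval. -/
noncomputable def avgProd (a b : ℝ) (n k : ℕ) (w : ℝ → ℝ) : ℝ :=
  avg a b n k w * avg a b n k w⁻¹

theorem MemA2.inv_pos {Q a b : ℝ} {w : ℝ → ℝ} (hw : MemA2 Q a b w) : ∀ᵐ t, 0 < w⁻¹ t := by
  filter_upwards [hw.1.2] with t ht
  simpa using ht

theorem MemA2.avgProd_mem {Q a b : ℝ} (hab : a < b) {w : ℝ → ℝ} (hw : MemA2 Q a b w) {n k : ℕ}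
    (hk : k < 2 ^ n) : avgProd a b n k w ∈ Icc 1 Q :=
  ⟨one_le_avg_mul_avg_inv hab hk (hw.1.integrableOn a b) hw.2.1 hw.1.2, hw.2.2 n k hk⟩

/-- One step of the induction. The relative deviations of the left averages serve as `t₁`, `t₂`;
they have modulus below one because both halves have positive averages, and `Δ_J w = 2 t₁ ⟨w⟩_J`
produces the factor 4. -/
theorem MemA2.coeff_add_le {Q a b : ℝ} (hab : a < b) {w : ℝ → ℝ} (hw : MemA2 Q a b w)
    {Φ g : ℝ → ℝ} (h : MainInequality Q Φ g) {n k : ℕ} (hk : k < 2 ^ n) :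
    coeff Φ a b n k w + (b - a) / 2 ^ (n + 1) *
      (g (avgProd a b (n + 1) (2 * k) w) + g (avgProd a b (n + 1) (2 * k + 1) w)) ≤
      (b - a) / 2 ^ n * g (avgProd a b n k w) := by
  have hd : 0 < (b - a) / 2 ^ n := by have := sub_pos.2 hab; positivity
  have hk1 : 2 * k < 2 ^ (n + 1) := by rw [pow_succ]; omega
  have hk2 : 2 * k + 1 < 2 ^ (n + 1) := by rw [pow_succ]; omega
  have hu := hw.avgProd_mem hab hk
  have hu1 := hw.avgProd_mem hab hk1
  have hu2 := hw.avgProd_mem hab hk2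
  have hi := hw.1.integrableOn a b
  have p1 := avg_pos hab hk hi hw.1.2
  have p1' := avg_pos hab hk1 hi hw.1.2
  have p1'' := avg_pos hab hk2 hi hw.1.2
  have p2 := avg_pos hab hk hw.2.1 hw.inv_pos
  have p2' := avg_pos hab hk1 hw.2.1 hw.inv_pos
  have p2'' := avg_pos hab hk2 hw.2.1 hw.inv_pos
  have s1 := avg_eq_half hab hk hi
  have s2 := avg_eq_half hab hk hw.2.1
  unfold coeff delta
  rw [volume_real_dyadic hab]
  unfold avgProd at *
  set x := avg a b n k w
  set y := avg a b n k w⁻¹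
  set x' := avg a b (n + 1) (2 * k) w
  set y' := avg a b (n + 1) (2 * k) w⁻¹
  set x'' := avg a b (n + 1) (2 * k + 1) w
  set y'' := avg a b (n + 1) (2 * k + 1) w⁻¹
  have key := h (x * y) ((x' - x) / x) ((y' - y) / y) hu.1 hu.2
    (by rw [abs_lt, lt_div_iff₀ p1, div_lt_iff₀ p1]; constructor <;> linarith)
    (by rw [abs_lt, lt_div_iff₀ p2, div_lt_iff₀ p2]; constructor <;> linarith)
  have e1 : x * y * ((1 + (x' - x) / x) * (1 + (y' - y) / y)) = x' * y' := by
    field_simp; ring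
  have e2 : x * y * ((1 - (x' - x) / x) * (1 - (y' - y) / y)) = x'' * y'' := by
    have f1 : x'' = 2 * x - x' := by linarith
    have f2 : y'' = 2 * y - y' := by linarith
    rw [f1, f2]
    field_simp; ring
  rw [e1, e2] at key
  have key := mul_le_mul_of_nonneg_left (key hu1 hu2) hd.le
  refine le_trans (le_of_eq ?_) key
  have f1 : x' - x'' = 2 * (x' - x) := by linarith
  have f2 : y' - y'' = 2 * (y' - y) := by linarith
  rw [f1, f2, pow_succ]
  field_simp
  ring

theorem MemA2.sum_coeff_add_le {Q a b : ℝ} (hab : a < b) {w : ℝ → ℝ} (hw : MemA2 Q a b w)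
    {Φ g : ℝ → ℝ} (h : MainInequality Q Φ g) (N : ℕ) :
    ∑ n ∈ Finset.range N, ∑ k ∈ Finset.range (2 ^ n), coeff Φ a b n k w +
      ∑ k ∈ Finset.range (2 ^ N), (b - a) / 2 ^ N * g (avgProd a b N k w) ≤
      (b - a) * g (avgProd a b 0 0 w) := by
  induction N with
  | zero => simp
  | succ N ih =>
    refine le_trans ?_ ih
    rw [Finset.sum_range_succ, add_assoc]
    gcongr
    rw [pow_succ 2 N, mul_comm (2 ^ N) 2, sum_range_two_mul, ← Finset.sum_add_distrib]
    apply Finset.sum_le_sum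
    intro k hk
    have := hw.coeff_add_le hab h (Finset.mem_range.1 hk)
    rwa [mul_add] at this

theorem coeff_nonneg {Q a b : ℝ} (hab : a < b) {w : ℝ → ℝ} (hw : MemA2 Q a b w)
    {Φ : ℝ → ℝ} (hΦ : ∀ u, 1 ≤ u → 0 ≤ Φ u) {n k : ℕ} (hk : k < 2 ^ n) :
    0 ≤ coeff Φ a b n k w := by
  have := hΦ _ (hw.avgProd_mem hab hk).1
  unfold avgProd at this
  unfold coeff
  positivity

theorem dyadicSum_le_of_forall {Q a b : ℝ} (hab : a < b) {w : ℝ → ℝ} (hw : MemA2 Q a b w)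
    {Φ : ℝ → ℝ} (hΦ : ∀ u, 1 ≤ u → 0 ≤ Φ u) {C : ℝ}
    (h : ∀ N, ∑ n ∈ Finset.range N, ∑ k ∈ Finset.range (2 ^ n), coeff Φ a b n k w ≤ (b - a) * C) :
    dyadicSum Φ a b w ≤ ENNReal.ofReal C := by
  have hba := sub_pos.2 hab
  have : ∑' n : ℕ, ∑ k ∈ Finset.range (2 ^ n), ENNReal.ofReal (coeff Φ a b n k w) ≤
      ENNReal.ofReal (b - a) * ENNReal.ofReal C := by
    rw [ENNReal.tsum_eq_iSup_nat]
    apply iSup_le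
    intro N
    rw [← ENNReal.ofReal_mul hba.le]
    refine le_trans (le_of_eq ?_) (ENNReal.ofReal_le_ofReal (h N))
    rw [ENNReal.ofReal_sum_of_nonneg]
    · apply Finset.sum_congr rfl
      intro n _
      rw [ENNReal.ofReal_sum_of_nonneg]
      intro k hk
      exact coeff_nonneg hab hw hΦ (Finset.mem_range.1 hk)
    · intro n _
      apply Finset.sum_nonneg
      intro k hk
      exact coeff_nonneg hab hw hΦ (Finset.mem_range.1 hk)
  unfold dyadicSum
  rw [Real.volume_Ico]
  calc _ ≤ (ENNReal.ofReal (b - a))⁻¹ * (ENNReal.ofReal (b - a) * ENNReal.ofReal C) := by gcongr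
    _ = _ := by
      rw [← mul_assoc, ENNReal.inv_mul_cancel (by simpa using hba) ENNReal.ofReal_ne_top, one_mul]

theorem avgProd_zero_of_mem_weights {Q a b : ℝ} {x : ℝ × ℝ} {w : ℝ → ℝ}
    (hw : w ∈ weights Q a b x) : avgProd a b 0 0 w = x.1 * x.2 := by
  rw [avgProd, avg_zero_zero, avg_zero_zero, hw.2.1, hw.2.2]

theorem dyadicSum_le_of_mainInequality {Q a b : ℝ} (hab : a < b) {x : ℝ × ℝ} {w : ℝ → ℝ}
    (hw : w ∈ weights Q a b x) {Φ g : ℝ → ℝ} (hΦ : ∀ u, 1 ≤ u → 0 ≤ Φ u)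
    (hg : ∀ u ∈ Icc 1 Q, 0 ≤ g u) (h : MainInequality Q Φ g) :
    dyadicSum Φ a b w ≤ ENNReal.ofReal (g (x.1 * x.2)) := by
  apply dyadicSum_le_of_forall hab hw.1 hΦ
  intro N
  have h1 := hw.1.sum_coeff_add_le hab h N
  rw [avgProd_zero_of_mem_weights hw] at h1
  refine le_trans (le_add_of_nonneg_right ?_) h1
  apply Finset.sum_nonneg
  intro k hk
  have := hg _ (hw.1.avgProd_mem hab (Finset.mem_range.1 hk))
  have := sub_pos.2 hab
  positivity

/-! ### Vanishing of the remainder and lower bounds for dyadic sums. -/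

/-- The number of the dyadic interval of generation `n` that contains `t`. -/
noncomputable def dyadicIndex (a b : ℝ) (n : ℕ) (t : ℝ) : ℕ :=
  ⌊(t - a) / ((b - a) / 2 ^ n)⌋₊

theorem measurable_dyadicIndex (a b : ℝ) (n : ℕ) : Measurable (dyadicIndex a b n) := by
  unfold dyadicIndex
  exact Nat.measurable_floor.comp ((measurable_id.sub_const a).div_const _)

theorem mem_dyadic_iff {a b : ℝ} (hab : a < b) {n k : ℕ} {t : ℝ} (ht : a ≤ t) :
    t ∈ dyadic a b n k ↔ dyadicIndex a b n t = k := by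
  have hd : 0 < (b - a) / 2 ^ n := by have := sub_pos.2 hab; positivity
  rw [dyadicIndex, Nat.floor_eq_iff (div_nonneg (sub_nonneg.2 ht) hd.le), le_div_iff₀ hd,
    div_lt_iff₀ hd, dyadic, mem_Ico]
  constructor <;> rintro ⟨h1, h2⟩ <;> constructor <;> linarith

theorem le_of_mem_dyadic {a b : ℝ} (hab : a < b) {n k : ℕ} {t : ℝ} (ht : t ∈ dyadic a b n k) :
    a ≤ t := by
  have hd : 0 < (b - a) / 2 ^ n := by have := sub_pos.2 hab; positivity
  have : 0 ≤ (k : ℝ) * ((b - a) / 2 ^ n) := by positivity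
  linarith [ht.1]

theorem dyadicIndex_lt {a b : ℝ} (hab : a < b) {n : ℕ} {t : ℝ} (ht : t ∈ Ico a b) :
    dyadicIndex a b n t < 2 ^ n := by
  have hd : 0 < (b - a) / 2 ^ n := by have := sub_pos.2 hab; positivity
  rw [dyadicIndex, Nat.floor_lt (div_nonneg (sub_nonneg.2 ht.1) hd.le), div_lt_iff₀ hd]
  have : ((2 ^ n : ℕ) : ℝ) * ((b - a) / 2 ^ n) = b - a := by push_cast; field_simp
  rw [this]
  linarith [ht.2]

theorem biUnion_dyadic {a b : ℝ} (hab : a < b) (n : ℕ) :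
    ⋃ k ∈ Finset.range (2 ^ n), dyadic a b n k = Ico a b := by
  apply Subset.antisymm
  · exact iUnion₂_subset fun k hk => dyadic_subset hab (Finset.mem_range.1 hk)
  · intro t ht
    rw [mem_iUnion₂]
    exact ⟨dyadicIndex a b n t, Finset.mem_range.2 (dyadicIndex_lt hab ht),
      (mem_dyadic_iff hab ht.1).2 rfl⟩

theorem sum_dyadic_eq_integral {a b : ℝ} (hab : a < b) (n : ℕ) (f : ℕ → ℝ) :
    ∑ k ∈ Finset.range (2 ^ n), (b - a) / 2 ^ n * f k =
      ∫ t in Ico a b, f (dyadicIndex a b n t) := by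
  have hconst : ∀ k, EqOn (fun _ : ℝ => f k) (fun t => f (dyadicIndex a b n t))
      (dyadic a b n k) := fun k t ht => by
    simp only [(mem_dyadic_iff hab (le_of_mem_dyadic hab ht)).1 ht]
  rw [← biUnion_dyadic hab n, integral_biUnion_finset]
  · apply Finset.sum_congr rfl
    intro k _
    rw [← setIntegral_congr_fun (measurableSet_dyadic a b n k) (hconst k), setIntegral_const,
      volume_real_dyadic hab, smul_eq_mul]
  · intro k _
    exact measurableSet_dyadic a b n k
  · intro j _ k _ hjk
    refine Set.disjoint_left.2 fun t hj hk => hjk ?_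
    have ht := le_of_mem_dyadic hab hj
    rw [← (mem_dyadic_iff hab ht).1 hj, (mem_dyadic_iff hab ht).1 hk]
  · intro k _
    refine IntegrableOn.congr_fun ?_ (hconst k) (measurableSet_dyadic a b n k)
    exact integrableOn_const (by rw [volume_dyadic]; exact ENNReal.ofReal_ne_top)

/-- Lebesgue differentiation along the dyadic intervals. -/
theorem ae_tendsto_avg {a b : ℝ} (hab : a < b) {w : ℝ → ℝ} (hw : IntegrableOn w (Ico a b)) :
    ∀ᵐ t ∂volume.restrict (Ico a b),
      Tendsto (fun n => avg a b n (dyadicIndex a b n t) w) atTop (𝓝 (w t)) := by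
  have hloc : LocallyIntegrable ((Ico a b).indicator w) :=
    ((integrable_indicator_iff measurableSet_Ico).2 hw).locallyIntegrable
  rw [ae_restrict_iff' measurableSet_Ico]
  filter_upwards [IsUnifLocDoublingMeasure.ae_tendsto_average volume hloc 1] with t ht hmem
  -- Up to an endpoint, each dyadic interval is the closed ball of radius `δ n` about its midpoint
  -- `c n`. It contains `t`, so the dilation constant 1 suffices in the differentiation theorem.
  set δ : ℕ → ℝ := fun n => (b - a) / 2 ^ n / 2 with hδ
  set c : ℕ → ℝ := fun n => a + (dyadicIndex a b n t + 1 / 2) * ((b - a) / 2 ^ n) with hc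
  have hδpos : ∀ n, 0 < δ n := fun n => by have := sub_pos.2 hab; positivity
  have hball : ∀ n, Metric.closedBall (c n) (δ n) =
      Icc (a + dyadicIndex a b n t * ((b - a) / 2 ^ n))
        (a + (dyadicIndex a b n t + 1) * ((b - a) / 2 ^ n)) := fun n => by
    rw [Real.closedBall_eq_Icc]
    congr 1 <;> simp only [hδ, hc] <;> ring
  have hin : ∀ n, t ∈ dyadic a b n (dyadicIndex a b n t) := fun n =>
    (mem_dyadic_iff hab hmem.1).2 rfl
  have hlim : Tendsto δ atTop (𝓝[>] 0) := by
    refine tendsto_nhdsWithin_iff.2 ⟨?_, Eventually.of_forall hδpos⟩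
    have h1 : Tendsto (fun n : ℕ => (b - a) / 2 * (1 / 2 : ℝ) ^ n) atTop (𝓝 ((b - a) / 2 * 0)) :=
      (tendsto_pow_atTop_nhds_zero_of_lt_one (by norm_num) (by norm_num)).const_mul _
    rw [mul_zero] at h1
    refine h1.congr fun n => ?_
    simp only [hδ]
    rw [one_div, inv_pow]
    ring
  have h2 := ht c δ hlim (Eventually.of_forall fun n => by
    rw [one_mul, hball]
    exact Ico_subset_Icc_self (hin n))
  rw [indicator_of_mem hmem] at h2
  refine h2.congr fun n => ?_
  rw [hball, setAverage_congr Ico_ae_eq_Icc.symm, avg, dyadic]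
  apply setAverage_congr_fun measurableSet_Ico
  refine Eventually.of_forall fun y hy => ?_
  exact indicator_of_mem (dyadic_subset hab (dyadicIndex_lt hab hmem) hy) w

/-- The sum is the integral of a step function. At almost every point the averages converge to `w`
and `w⁻¹`, whose product is 1, where `g` vanishes; dominated convergence finishes. -/
theorem MemA2.tendsto_sum_avgProd {Q a b : ℝ} (hab : a < b) {w : ℝ → ℝ} (hw : MemA2 Q a b w)
    {g : ℝ → ℝ} (hg : ContinuousAt g 1) (hg1 : g 1 = 0) {C : ℝ} (hC : ∀ u ∈ Icc 1 Q, |g u| ≤ C) :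
    Tendsto (fun N => ∑ k ∈ Finset.range (2 ^ N), (b - a) / 2 ^ N * g (avgProd a b N k w))
      atTop (𝓝 0) := by
  simp_rw [sum_dyadic_eq_integral hab]
  rw [← integral_zero ℝ ℝ (μ := volume.restrict (Ico a b))]
  apply tendsto_integral_of_dominated_convergence (fun _ => C)
  · intro n
    have : Measurable fun t => g (avgProd a b n (dyadicIndex a b n t) w) :=
      (measurable_from_nat (f := fun k => g (avgProd a b n k w))).comp
        (measurable_dyadicIndex a b n)
    exact this.aestronglyMeasurable
  · exact integrableOn_const (by rw [Real.volume_Ico]; exact ENNReal.ofReal_ne_top)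
  · intro n
    rw [ae_restrict_iff' measurableSet_Ico]
    refine Eventually.of_forall fun t ht => ?_
    exact hC _ (hw.avgProd_mem hab (dyadicIndex_lt hab ht))
  · filter_upwards [ae_tendsto_avg hab (hw.1.integrableOn a b), ae_tendsto_avg hab hw.2.1,
      ae_restrict_of_ae hw.1.2] with t h1 h2 h3
    have h4 := h1.mul h2
    rw [Pi.inv_apply, mul_inv_cancel₀ h3.ne'] at h4
    have h5 := hg.tendsto.comp h4
    rwa [hg1] at h5

/-- The lower estimate of the dyadic sum by a function that satisfies the reverse main
inequality. -/
theorem le_dyadicSum_of_mainInequality {Q a b : ℝ} (hab : a < b) {x : ℝ × ℝ} {w : ℝ → ℝ}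
    (hw : w ∈ weights Q a b x) {Φ g : ℝ → ℝ}
    (hg : ContinuousAt g 1) (hg1 : g 1 = 0) {C : ℝ} (hC : ∀ u ∈ Icc 1 Q, |g u| ≤ C)
    (h : MainInequality Q (-Φ) (-g)) :
    ENNReal.ofReal (g (x.1 * x.2)) ≤ dyadicSum Φ a b w := by
  have hba := sub_pos.2 hab
  set T : ℝ≥0∞ := ∑' n : ℕ, ∑ k ∈ Finset.range (2 ^ n), ENNReal.ofReal (coeff Φ a b n k w)
  have key : ENNReal.ofReal ((b - a) * g (x.1 * x.2)) ≤ T := by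
    have h0 := hw.1.tendsto_sum_avgProd hab hg hg1 hC
    have h1 : Tendsto (fun N => ENNReal.ofReal ((b - a) * g (x.1 * x.2) -
        ∑ k ∈ Finset.range (2 ^ N), (b - a) / 2 ^ N * g (avgProd a b N k w))) atTop
        (𝓝 (ENNReal.ofReal ((b - a) * g (x.1 * x.2) - 0))) :=
      ENNReal.tendsto_ofReal (tendsto_const_nhds.sub h0)
    rw [sub_zero] at h1
    apply le_of_tendsto' h1
    intro N
    have h2 := hw.1.sum_coeff_add_le hab h N
    rw [avgProd_zero_of_mem_weights hw] at h2
    have e1 : ∀ n k, coeff (-Φ) a b n k w = -coeff Φ a b n k w := fun n k => by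
      simp [coeff]
    simp only [e1, Pi.neg_apply, mul_neg, Finset.sum_neg_distrib] at h2
    calc _ ≤ ENNReal.ofReal (∑ n ∈ Finset.range N, ∑ k ∈ Finset.range (2 ^ n),
          coeff Φ a b n k w) := ENNReal.ofReal_le_ofReal (by linarith)
      _ ≤ ∑ n ∈ Finset.range N, ∑ k ∈ Finset.range (2 ^ n),
          ENNReal.ofReal (coeff Φ a b n k w) := by
        refine (Finset.le_sum_of_subadditive _ ENNReal.ofReal_zero.le ?_ _ _).trans ?_
        · exact fun _ _ => ENNReal.ofReal_add_le
        · refine Finset.sum_le_sum fun n _ => ?_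
          exact Finset.le_sum_of_subadditive _ ENNReal.ofReal_zero.le
            (fun _ _ => ENNReal.ofReal_add_le) _ _
      _ ≤ T := ENNReal.sum_le_tsum _
  unfold dyadicSum
  rw [Real.volume_Ico]
  calc _ = (ENNReal.ofReal (b - a))⁻¹ * ENNReal.ofReal ((b - a) * g (x.1 * x.2)) := by
        rw [ENNReal.ofReal_mul hba.le, ← mul_assoc,
          ENNReal.inv_mul_cancel (by simpa using hba) ENNReal.ofReal_ne_top, one_mul]
    _ ≤ _ := by gcongr

/-! ### Self-similarity, gluing of weights and attained values. -/

theorem dyadic_left (a b : ℝ) (n k : ℕ) : dyadic a b (n + 1) k = dyadic a ((a + b) / 2) n k := by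
  have : (b - a) / 2 ^ (n + 1) = ((a + b) / 2 - a) / 2 ^ n := by rw [pow_succ]; field_simp; ring
  rw [dyadic, dyadic, this]

theorem dyadic_right (a b : ℝ) (n k : ℕ) :
    dyadic a b (n + 1) (2 ^ n + k) = dyadic ((a + b) / 2) b n k := by
  have h1 : (b - a) / 2 ^ (n + 1) = (b - (a + b) / 2) / 2 ^ n := by
    rw [pow_succ]; field_simp; ring
  have h2 : a + 2 ^ n * ((b - (a + b) / 2) / 2 ^ n) = (a + b) / 2 := by field_simp; ring
  rw [dyadic, dyadic, h1]
  push_cast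
  congr 1 <;> linarith

theorem avg_left (a b : ℝ) (n k : ℕ) (w : ℝ → ℝ) :
    avg a b (n + 1) k w = avg a ((a + b) / 2) n k w := by
  rw [avg, avg, dyadic_left]

theorem avg_right (a b : ℝ) (n k : ℕ) (w : ℝ → ℝ) :
    avg a b (n + 1) (2 ^ n + k) w = avg ((a + b) / 2) b n k w := by
  rw [avg, avg, dyadic_right]

theorem delta_left (a b : ℝ) (n k : ℕ) (w : ℝ → ℝ) :
    delta a b (n + 1) k w = delta a ((a + b) / 2) n k w := by
  rw [delta, delta, avg_left a b (n + 1), avg_left a b (n + 1)]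

theorem delta_right (a b : ℝ) (n k : ℕ) (w : ℝ → ℝ) :
    delta a b (n + 1) (2 ^ n + k) w = delta ((a + b) / 2) b n k w := by
  rw [delta, delta, ← avg_right, ← avg_right]
  congr 2 <;> ring

theorem coeff_left (Φ : ℝ → ℝ) (a b : ℝ) (n k : ℕ) (w : ℝ → ℝ) :
    coeff Φ a b (n + 1) k w = coeff Φ a ((a + b) / 2) n k w := by
  simp only [coeff, dyadic_left, avg_left, delta_left]

theorem coeff_right (Φ : ℝ → ℝ) (a b : ℝ) (n k : ℕ) (w : ℝ → ℝ) :
    coeff Φ a b (n + 1) (2 ^ n + k) w = coeff Φ ((a + b) / 2) b n k w := by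
  simp only [coeff, dyadic_right, avg_right, delta_right]

/-- The term `n = 0` is split off, and each later generation is distributed over the two halves;
their normalizing factors are twice `|I|⁻¹`, hence the mean. -/
theorem dyadicSum_eq_half {a b : ℝ} (hab : a < b) (Φ : ℝ → ℝ) (w : ℝ → ℝ) :
    dyadicSum Φ a b w =
      ENNReal.ofReal (Φ (avg a b 0 0 w * avg a b 0 0 w⁻¹) *
        ((delta a b 0 0 w) ^ 2 / (avg a b 0 0 w) ^ 2 +
          (delta a b 0 0 w⁻¹) ^ 2 / (avg a b 0 0 w⁻¹) ^ 2)) +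
      (dyadicSum Φ a ((a + b) / 2) w + dyadicSum Φ ((a + b) / 2) b w) / 2 := by
  have hba := sub_pos.2 hab
  have hl : (volume (Ico a ((a + b) / 2)))⁻¹ = 2 * (volume (Ico a b))⁻¹ := by
    rw [Real.volume_Ico, Real.volume_Ico, show (a + b) / 2 - a = 2⁻¹ * (b - a) by ring,
      ENNReal.ofReal_mul (by norm_num), ENNReal.mul_inv (by simp) (by simp),
      ENNReal.ofReal_inv_of_pos (by norm_num)]
    simp
  have hr : (volume (Ico ((a + b) / 2) b))⁻¹ = 2 * (volume (Ico a b))⁻¹ := by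
    rw [← hl, Real.volume_Ico, Real.volume_Ico]
    congr 2; ring
  rw [dyadicSum, dyadicSum, dyadicSum, hl, hr, tsum_eq_zero_add' ENNReal.summable, mul_add]
  congr 1
  · simp only [pow_zero, Finset.range_one, Finset.sum_singleton]
    rw [coeff, dyadic_zero, mul_assoc, ENNReal.ofReal_mul measureReal_nonneg, ← mul_assoc,
      ofReal_measureReal (by rw [Real.volume_Ico]; exact ENNReal.ofReal_ne_top),
      ENNReal.inv_mul_cancel (by rw [Real.volume_Ico]; simpa using hba)
        (by rw [Real.volume_Ico]; exact ENNReal.ofReal_ne_top), one_mul]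
  · have : ∀ n, ∑ k ∈ Finset.range (2 ^ (n + 1)), ENNReal.ofReal (coeff Φ a b (n + 1) k w) =
        ∑ k ∈ Finset.range (2 ^ n), ENNReal.ofReal (coeff Φ a ((a + b) / 2) n k w) +
          ∑ k ∈ Finset.range (2 ^ n), ENNReal.ofReal (coeff Φ ((a + b) / 2) b n k w) := by
      intro n
      rw [pow_succ, mul_two, Finset.sum_range_add]
      simp only [coeff_right]
      simp only [coeff_left]
    simp only [this]
    rw [ENNReal.tsum_add, mul_assoc, mul_assoc, ← mul_add, ← mul_add, ENNReal.div_eq_inv_mul,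
      ← mul_assoc, ENNReal.inv_mul_cancel (by simp) (by simp), one_mul]

theorem avg_congr {a b : ℝ} (hab : a < b) {n k : ℕ} (hk : k < 2 ^ n) {w v : ℝ → ℝ}
    (h : EqOn w v (Ico a b)) : avg a b n k w = avg a b n k v :=
  setAverage_congr_fun (measurableSet_dyadic a b n k)
    (Filter.Eventually.of_forall fun _ ht => h (dyadic_subset hab hk ht))

theorem EqOn_inv {w v : ℝ → ℝ} {s : Set ℝ} (h : EqOn w v s) : EqOn w⁻¹ v⁻¹ s := fun t ht => by
  simp only [Pi.inv_apply, h ht]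

theorem dyadicSum_congr {a b : ℝ} (hab : a < b) (Φ : ℝ → ℝ) {w v : ℝ → ℝ}
    (h : EqOn w v (Ico a b)) : dyadicSum Φ a b w = dyadicSum Φ a b v := by
  have hi := EqOn_inv h
  unfold dyadicSum
  congr 1
  refine tsum_congr fun n => Finset.sum_congr rfl fun k hk => ?_
  have hk := Finset.mem_range.1 hk
  have hk1 : 2 * k < 2 ^ (n + 1) := by rw [pow_succ]; omega
  have hk2 : 2 * k + 1 < 2 ^ (n + 1) := by rw [pow_succ]; omega
  simp only [coeff, delta, avg_congr hab hk h, avg_congr hab hk hi, avg_congr hab hk1 h,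
    avg_congr hab hk1 hi, avg_congr hab hk2 h, avg_congr hab hk2 hi]

/-- Two weights on the halves of an interval form a weight on the interval. -/
theorem exists_concat {Q a b : ℝ} (hab : a < b) (Φ : ℝ → ℝ) {x y z : ℝ × ℝ} {w v : ℝ → ℝ}
    (hx1 : x.1 = (y.1 + z.1) / 2) (hx2 : x.2 = (y.2 + z.2) / 2) (hxQ : x.1 * x.2 ≤ Q)
    (hw : w ∈ weights Q a ((a + b) / 2) y) (hv : v ∈ weights Q ((a + b) / 2) b z) :
    ∃ f ∈ weights Q a b x, dyadicSum Φ a b f =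
      ENNReal.ofReal (Φ (x.1 * x.2) *
        ((y.1 - z.1) ^ 2 / x.1 ^ 2 + (y.2 - z.2) ^ 2 / x.2 ^ 2)) +
      (dyadicSum Φ a ((a + b) / 2) w + dyadicSum Φ ((a + b) / 2) b v) / 2 := by
  classical
  set m := (a + b) / 2 with hm
  have ham : a < m := by linarith
  have hmb : m < b := by linarith
  set f : ℝ → ℝ := (Iio m).piecewise w v with hf
  have hfw : EqOn f w (Ico a m) := fun t ht => piecewise_eq_of_mem _ _ _ ht.2
  have hfv : EqOn f v (Ico m b) := fun t ht =>
    piecewise_eq_of_notMem _ _ _ (notMem_Iio.2 ht.1)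
  have hunion : Ico a b = Ico a m ∪ Ico m b := (Ico_union_Ico_eq_Ico ham.le hmb.le).symm
  have hfloc : LocallyIntegrable f := by
    have : f = (Iio m).indicator w + (Ici m).indicator v := by
      ext t
      by_cases ht : t < m
      · simp [hf, ht]
      · simp [hf, ht, not_lt.1 ht]
    rw [this]
    exact (hw.1.1.1.indicator measurableSet_Iio).add (hv.1.1.1.indicator measurableSet_Ici)
  have hfpos : ∀ᵐ t, 0 < f t := by
    filter_upwards [hw.1.1.2, hv.1.1.2] with t h1 h2
    by_cases ht : t < m
    · simpa [hf, ht] using h1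
    · simpa [hf, ht] using h2
  have hfi : IntegrableOn f⁻¹ (Ico a b) := by
    rw [hunion]
    exact (hw.1.2.1.congr_fun (EqOn_inv hfw).symm measurableSet_Ico).union
      (hv.1.2.1.congr_fun (EqOn_inv hfv).symm measurableSet_Ico)
  have hfint : IntegrableOn f (Ico a b) := IsWeight.integrableOn ⟨hfloc, hfpos⟩ a b
  have l1 : avg a b 1 0 f = y.1 := by
    rw [avg_left, avg_congr ham (by norm_num) hfw, avg_zero_zero, hw.2.1]
  have l2 : avg a b 1 0 f⁻¹ = y.2 := by
    rw [avg_left, avg_congr ham (by norm_num) (EqOn_inv hfw), avg_zero_zero, hw.2.2]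
  have r1 : avg a b 1 1 f = z.1 := by
    have := avg_right a b 0 0 f
    norm_num at this
    rw [this, avg_congr hmb (by norm_num) hfv, avg_zero_zero, hv.2.1]
  have r2 : avg a b 1 1 f⁻¹ = z.2 := by
    have := avg_right a b 0 0 f⁻¹
    norm_num at this
    rw [this, avg_congr hmb (by norm_num) (EqOn_inv hfv), avg_zero_zero, hv.2.2]
  have c1 : avg a b 0 0 f = x.1 := by
    have := avg_eq_half hab (n := 0) (k := 0) (by norm_num) hfint
    rw [this, hx1, ← l1, ← r1]
  have c2 : avg a b 0 0 f⁻¹ = x.2 := by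
    have := avg_eq_half hab (n := 0) (k := 0) (by norm_num) hfi
    rw [this, hx2, ← l2, ← r2]
  refine ⟨f, ⟨⟨⟨hfloc, hfpos⟩, hfi, ?_⟩, ?_, ?_⟩, ?_⟩
  -- A proper dyadic subinterval lies in one half, where the bound is inherited; only the top
  -- interval needs `x.1 * x.2 ≤ Q`.
  · intro n k hk
    cases n with
    | zero =>
      obtain rfl : k = 0 := by simpa using hk
      rwa [c1, c2]
    | succ n =>
      rcases lt_or_ge k (2 ^ n) with h | h
      · rw [avg_left, avg_left, avg_congr ham h hfw, avg_congr ham h (EqOn_inv hfw)]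
        exact hw.1.2.2 n k h
      · obtain ⟨j, rfl⟩ := Nat.exists_eq_add_of_le h
        have hj : j < 2 ^ n := by rw [pow_succ] at hk; omega
        rw [avg_right, avg_right, avg_congr hmb hj hfv, avg_congr hmb hj (EqOn_inv hfv)]
        exact hv.1.2.2 n j hj
  · rw [← avg_zero_zero, c1]
  · rw [← c2, avg_zero_zero]
  · rw [dyadicSum_eq_half hab, dyadicSum_congr ham Φ hfw, dyadicSum_congr hmb Φ hfv, c1, c2]
    simp only [delta, mul_zero, zero_add, l1, l2, r1, r2]

/-- The value `c` of the dyadic sum is attained at all points of the hyperbola `x₁ x₂ = u`, on all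
intervals. -/
def Attains (Q : ℝ) (Φ : ℝ → ℝ) (u c : ℝ) : Prop :=
  0 ≤ c ∧ ∀ (a b : ℝ) (x : ℝ × ℝ), a < b → 0 < x.1 → 0 < x.2 → x.1 * x.2 = u →
    ∃ w ∈ weights Q a b x, dyadicSum Φ a b w = ENNReal.ofReal c

theorem avg_const {a b : ℝ} (hab : a < b) (n k : ℕ) (c : ℝ) :
    avg a b n k (fun _ => c) = c := by
  have := sub_pos.2 hab
  rw [avg_eq hab, setIntegral_const, volume_real_dyadic hab, smul_eq_mul,
    inv_mul_cancel_left₀ (by positivity)]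

theorem Attains.one {Q : ℝ} (hQ : 1 ≤ Q) (Φ : ℝ → ℝ) : Attains Q Φ 1 0 := by
  refine ⟨le_rfl, fun a b x hab h1 h2 hx => ?_⟩
  have hinv : (fun _ : ℝ => x.1)⁻¹ = fun _ : ℝ => x.2 := by
    ext t
    exact inv_eq_of_mul_eq_one_right hx
  refine ⟨fun _ => x.1, ⟨⟨⟨locallyIntegrable_const _, Filter.Eventually.of_forall fun _ => h1⟩,
    ?_, ?_⟩, ?_, ?_⟩, ?_⟩
  · rw [hinv]
    exact (locallyIntegrable_const x.2).integrableOn_isCompact isCompact_Icc |>.mono_set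
      Ico_subset_Icc_self
  · intro n k _
    rw [hinv, avg_const hab, avg_const hab, hx]
    exact hQ
  · rw [← avg_zero_zero, avg_const hab]
  · have := avg_const hab 0 0 x.2
    rwa [← hinv, avg_zero_zero] at this
  · simp [dyadicSum, coeff, delta, hinv, avg_const hab]

/-- Since `Attains` holds on all intervals and at all points of a hyperbola, weights for the two
children can be chosen independently and glued. -/
theorem Attains.split {Q : ℝ} {Φ : ℝ → ℝ} {u t₁ t₂ c d : ℝ} (huQ : u ≤ Q) (hΦ : 0 ≤ Φ u)
    (h1 : |t₁| < 1) (h2 : |t₂| < 1) (hc : Attains Q Φ (u * ((1 + t₁) * (1 + t₂))) c)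
    (hd : Attains Q Φ (u * ((1 - t₁) * (1 - t₂))) d) :
    Attains Q Φ u ((c + d) / 2 + 4 * Φ u * (t₁ ^ 2 + t₂ ^ 2)) := by
  have hc0 := hc.1
  have hd0 := hd.1
  refine ⟨by positivity, fun a b x hab hx1 hx2 hx => ?_⟩
  rw [abs_lt] at h1 h2
  obtain ⟨w, hw, hw'⟩ := hc.2 a ((a + b) / 2) (x.1 * (1 + t₁), x.2 * (1 + t₂)) (by linarith)
    (mul_pos hx1 (by linarith)) (mul_pos hx2 (by linarith)) (by simp only; rw [← hx]; ring)
  obtain ⟨v, hv, hv'⟩ := hd.2 ((a + b) / 2) b (x.1 * (1 - t₁), x.2 * (1 - t₂)) (by linarith)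
    (mul_pos hx1 (by linarith)) (mul_pos hx2 (by linarith)) (by simp only; rw [← hx]; ring)
  obtain ⟨f, hf, hf'⟩ := exists_concat hab Φ (x := x) (by simp only; ring) (by simp only; ring)
    (by rwa [hx]) hw hv
  refine ⟨f, hf, ?_⟩
  rw [hf', hw', hv', ← ENNReal.ofReal_add hc0 hd0, hx, add_comm,
    show (2 : ℝ≥0∞) = ENNReal.ofReal 2 by simp, ← ENNReal.ofReal_div_of_pos (by norm_num),
    ← ENNReal.ofReal_add (by positivity) (by positivity)]
  congr 2
  field_simp
  ring

/-- With `t₂ = -t₁ = -t` both children have product `u (1 - t²)`, which equals `v` for `t = √(1 - v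
/ u)`; the gain is `8 Φ(u) t²`. -/
theorem Attains.step {Q : ℝ} {Φ : ℝ → ℝ} {u v c : ℝ} (hv : 0 < v) (hvu : v ≤ u) (huQ : u ≤ Q)
    (hΦ : 0 ≤ Φ u) (hc : Attains Q Φ v c) : Attains Q Φ u (c + 8 * (Φ u / u) * (u - v)) := by
  have hu := hv.trans_le hvu
  have h0 : 0 ≤ 1 - v / u := by rw [sub_nonneg, div_le_one hu]; exact hvu
  have hsq := Real.sq_sqrt h0
  set t := Real.sqrt (1 - v / u)
  have ht : 0 ≤ t := Real.sqrt_nonneg _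
  have hvu0 : 0 < v / u := by positivity
  have ht1 : t < 1 := by nlinarith
  have e1 : u * ((1 + t) * (1 + -t)) = v := by
    rw [show (1 + t) * (1 + -t) = 1 - t ^ 2 by ring, hsq]; field_simp; ring
  have e2 : u * ((1 - t) * (1 - -t)) = v := by rw [← e1]; ring
  have habs : |t| < 1 := by rwa [abs_of_nonneg ht]
  have := Attains.split huQ hΦ habs (by rwa [abs_neg]) (by rwa [e1]) (e2.symm ▸ hc)
  convert this using 1
  rw [neg_sq, hsq]
  field_simp
  ring

/-! ### Values attained by first-order steps. -/

theorem exists_dist_le_of_continuousOn {f : ℝ → ℝ} {A B : ℝ} (hf : ContinuousOn f (Icc A B))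
    {η : ℝ} (hη : 0 < η) :
    ∃ δ > 0, ∀ x ∈ Icc A B, ∀ y ∈ Icc A B, |x - y| ≤ δ → |f x - f y| ≤ η := by
  have h := isCompact_Icc.uniformContinuousOn_of_continuous hf
  rw [Metric.uniformContinuousOn_iff] at h
  obtain ⟨δ, hδ, h⟩ := h η hη
  refine ⟨δ / 2, by positivity, fun x hx y hy hxy => ?_⟩
  have := h x hx y hy (by rw [Real.dist_eq]; linarith)
  rw [Real.dist_eq] at this
  exact this.le

/-- Sums of first-order steps approximate the integral of `8 Φ(v) / v`. -/
theorem Attains.exists_near {Q : ℝ} (hQ : 1 ≤ Q) {Φ F : ℝ → ℝ} (hΦ : ∀ v, 1 ≤ v → 0 ≤ Φ v)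
    (hcont : ContinuousOn (fun v => 8 * (Φ v / v)) (Icc 1 Q))
    (hF : ∀ v ∈ Icc 1 Q, HasDerivAt F (8 * (Φ v / v)) v) (hF1 : F 1 = 0)
    {u : ℝ} (hu : u ∈ Icc 1 Q) {ε : ℝ} (hε : 0 < ε) :
    ∃ c, |c - F u| ≤ ε ∧ Attains Q Φ u c := by
  set η : ℝ := ε / Q with hηdef
  have hQ0 : 0 < Q := by linarith
  have hη : 0 < η := by positivity
  obtain ⟨δ₀, hδ₀, hmod⟩ := exists_dist_le_of_continuousOn hcont hη
  obtain ⟨N, hN⟩ := exists_nat_gt ((u - 1) / δ₀)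
  have hN' : u - 1 < N * δ₀ := by rwa [div_lt_iff₀ hδ₀] at hN
  have hu1 : 0 ≤ u - 1 := by linarith [hu.1]
  have hNpos : (0 : ℝ) < N := by
    by_contra h
    nlinarith [not_lt.1 h]
  set δ : ℝ := (u - 1) / N with hδ
  have hδ0 : 0 ≤ δ := by positivity
  have hδδ₀ : δ ≤ δ₀ := by rw [hδ, div_le_iff₀ hNpos]; linarith
  have hNδ : N * δ = u - 1 := by rw [hδ]; field_simp
  have key : ∀ k : ℕ, k ≤ N →
      ∃ c, |c - F (1 + k * δ)| ≤ k * (η * δ) ∧ Attains Q Φ (1 + k * δ) c := by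
    intro k
    induction k with
    | zero => exact fun _ => ⟨0, by simp [hF1], by simpa using Attains.one hQ Φ⟩
    | succ k ih =>
      intro hk
      obtain ⟨c, hc, hA⟩ := ih (by omega)
      have hkN : ((k + 1 : ℕ) : ℝ) ≤ N := by exact_mod_cast hk
      have hle : ((k + 1 : ℕ) : ℝ) * δ ≤ N * δ := by gcongr
      push_cast at hle hkN ⊢
      set v : ℝ := 1 + k * δ with hv
      set v' : ℝ := 1 + (k + 1) * δ with hv'
      have hkδ : 0 ≤ k * δ := by positivity
      have hvv : v' - v = δ := by rw [hv, hv']; ring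
      have hv1 : 1 ≤ v := by linarith
      have hvQ : v' ≤ Q := by linarith [hu.2]
      refine ⟨_, ?_, hA.step (by linarith) (by linarith : v ≤ v') hvQ (hΦ _ (by linarith))⟩
      rcases hδ0.eq_or_lt with h0 | h0
      · have : v' = v := by linarith
        rw [this]
        simpa [← h0] using hc
      -- The step uses the density at the right end `v'`, while the increment of `F` uses it at some
      -- `ξ` in between; uniform continuity makes the discrepancy at most `η * δ`.
      · obtain ⟨ξ, hξ, hξ'⟩ := exists_hasDerivAt_eq_slope F (fun v => 8 * (Φ v / v))
          (by linarith : v < v')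
          (fun y hy => (hF y ⟨by linarith [hy.1], by linarith [hy.2]⟩).continuousAt.continuousWithinAt)
          (fun y hy => hF y ⟨by linarith [hy.1], by linarith [hy.2]⟩)
        rw [hvv, eq_div_iff h0.ne'] at hξ'
        have hm := hmod v' ⟨by linarith, hvQ⟩ ξ ⟨by linarith [hξ.1], by linarith [hξ.2]⟩
          (by rw [abs_of_nonneg (by linarith [hξ.2])]; linarith [hξ.1])
        have e : c + 8 * (Φ v' / v') * (v' - v) - F v' =
            (c - F v) + (8 * (Φ v' / v') - 8 * (Φ ξ / ξ)) * δ := by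
          rw [hvv]; linarith
        rw [e]
        refine (abs_add_le _ _).trans ?_
        rw [abs_mul, abs_of_pos h0]
        have := mul_le_mul_of_nonneg_right hm h0.le
        linarith
  obtain ⟨c, hc, hA⟩ := key N le_rfl
  rw [hNδ, add_sub_cancel] at hc hA
  refine ⟨c, hc.trans ?_, hA⟩
  calc N * (η * δ) = η * (u - 1) := by rw [← hNδ]; ring
    _ ≤ η * Q := by gcongr; linarith [hu.2]
    _ = ε := by rw [hηdef]; field_simp

/-! ### Discrete comparison with the second-order problem. -/

/-- A quantitative form of midpoint convexity. -/
theorem add_half_mul_sq_le_midpoint {f f' f'' : ℝ → ℝ} {m R c : ℝ} (hR : 0 ≤ R)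
    (hf : ∀ x ∈ Icc (m - R) (m + R), HasDerivAt f (f' x) x)
    (hf' : ∀ x ∈ Icc (m - R) (m + R), HasDerivAt f' (f'' x) x)
    (hc : ∀ r ∈ Icc 0 R, 2 * c ≤ f'' (m + r) + f'' (m - r)) :
    f m + c * R ^ 2 / 2 ≤ (f (m + R) + f (m - R)) / 2 := by
  have hin : ∀ r ∈ Icc 0 R, m + r ∈ Icc (m - R) (m + R) ∧ m - r ∈ Icc (m - R) (m + R) :=
    fun r hr => ⟨⟨by linarith [hr.1], by linarith [hr.2]⟩, ⟨by linarith [hr.2], by linarith [hr.1]⟩⟩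
  have hplus : ∀ r : ℝ, HasDerivAt (fun r => m + r) 1 r := fun r => (hasDerivAt_id r).const_add m
  have hminus : ∀ r : ℝ, HasDerivAt (fun r => m - r) (-1) r := fun r =>
    (hasDerivAt_id r).const_sub m
  have d1 : ∀ r ∈ Icc 0 R, HasDerivAt (fun r => f (m + r) + f (m - r) - c * r ^ 2)
      (f' (m + r) - f' (m - r) - 2 * c * r) r := fun r hr => by
    have h1 := (hf _ (hin r hr).1).comp r (hplus r)
    have h2 := (hf _ (hin r hr).2).comp r (hminus r)
    have h3 := ((hasDerivAt_pow 2 r).const_mul c)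
    refine ((h1.add h2).sub h3).congr_deriv ?_
    norm_num
    ring
  have d2 : ∀ r ∈ Icc 0 R, HasDerivAt (fun r => f' (m + r) - f' (m - r) - 2 * c * r)
      (f'' (m + r) + f'' (m - r) - 2 * c) r := fun r hr => by
    have h1 := (hf' _ (hin r hr).1).comp r (hplus r)
    have h2 := (hf' _ (hin r hr).2).comp r (hminus r)
    have h3 := ((hasDerivAt_id r).const_mul (2 * c))
    refine ((h1.sub h2).sub h3).congr_deriv ?_
    ring
  have mono1 : MonotoneOn (fun r => f' (m + r) - f' (m - r) - 2 * c * r) (Icc 0 R) := by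
    apply monotoneOn_of_hasDerivWithinAt_nonneg (convex_Icc 0 R)
      (fun r hr => (d2 r hr).continuousAt.continuousWithinAt)
      (fun r hr => (d2 r (interior_subset hr)).hasDerivWithinAt)
    intro r hr
    linarith [hc r (interior_subset hr)]
  have mono2 : MonotoneOn (fun r => f (m + r) + f (m - r) - c * r ^ 2) (Icc 0 R) := by
    apply monotoneOn_of_hasDerivWithinAt_nonneg (convex_Icc 0 R)
      (fun r hr => (d1 r hr).continuousAt.continuousWithinAt)
      (fun r hr => (d1 r (interior_subset hr)).hasDerivWithinAt)
    intro r hr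
    have hr := interior_subset hr
    have := mono1 (left_mem_Icc.2 hR) hr hr.1
    simpa using this
  have := mono2 (left_mem_Icc.2 hR) (right_mem_Icc.2 hR) hR
  simp only [add_zero, sub_zero] at this
  linarith

/-- A discrete comparison principle: `e` is almost midpoint convex, with almost non-negative slope
at the left end, hence almost non-decreasing. -/
theorem le_of_almost_convex {e : ℕ → ℝ} {K : ℕ} {A B : ℝ} (hB : 0 ≤ B) (hA : 0 ≤ A)
    (h0 : 0 < K → e 0 ≤ e 1 + A) (h : ∀ k, k + 2 ≤ K → e (k + 1) ≤ (e k + e (k + 2)) / 2 + B)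
    {j : ℕ} (hj : j ≤ K) : e j ≤ e K + K * (A + 2 * K * B) := by
  -- Almost convexity lets the decrement grow by at most `2 * B` per step.
  have hD : ∀ k, k < K → e k - e (k + 1) ≤ A + 2 * k * B := by
    intro k
    induction k with
    | zero => intro hk; have := h0 hk; simp only [Nat.cast_zero, zero_add]; linarith
    | succ k ih =>
      intro hk
      have h1 := ih (by omega)
      have h2 := h k (by omega)
      push_cast
      rw [show k + 1 + 1 = k + 2 by ring]
      linarith
  have hS : ∀ i, i ≤ K - j → e j ≤ e (j + i) + i * (A + 2 * K * B) := by
    intro i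
    induction i with
    | zero => simp
    | succ i ih =>
      intro hi
      have h1 := ih (by omega)
      have h2 := hD (j + i) (by omega)
      have h3 : ((j + i : ℕ) : ℝ) ≤ K := by exact_mod_cast (by omega : j + i ≤ K)
      have h4 : ((j + i : ℕ) : ℝ) * B ≤ K * B := by gcongr
      rw [← add_assoc]
      push_cast at *
      linarith
  have h1 := hS (K - j) le_rfl
  rw [Nat.add_sub_cancel' hj] at h1
  have h2 : ((K - j : ℕ) : ℝ) ≤ K := by exact_mod_cast Nat.sub_le K j
  have h3 : ((K - j : ℕ) : ℝ) * (A + 2 * K * B) ≤ K * (A + 2 * K * B) := by gcongr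
  linarith

/-- The minimality of the solution of `g'' = -16 κ`, `g 1 = 0`, `g' L = 16 L κ(L)` among the
functions `G` that satisfy the two infinitesimal inequalities. -/
theorem le_of_second_order {L : ℝ} {g g' κ G : ℝ → ℝ} (hg1 : g 1 = 0)
    (hg : ∀ s ∈ Icc 1 L, HasDerivAt g (g' s) s)
    (hg' : ∀ s ∈ Icc 1 L, HasDerivAt g' (-16 * κ s) s) (hκ : ContinuousOn κ (Icc 1 L))
    (hκ0 : ∀ s ∈ Icc 1 L, 0 ≤ κ s) (hgL : g' L = 16 * L * κ L)
    (hG0 : ∀ s ∈ Icc 1 L, 0 ≤ G s)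
    (hG2 : ∀ s δ, 0 < δ → 1 ≤ s - δ → s + δ ≤ L →
      (G (s + δ) + G (s - δ)) / 2 + 8 * κ s * δ ^ 2 ≤ G s)
    (hG1 : ∀ δ, 0 < δ → 1 ≤ L - δ → G (L - δ) + 8 * κ L * (L ^ 2 - (L - δ) ^ 2) ≤ G L)
    {s : ℝ} (hs : s ∈ Icc 1 L) : g s ≤ G s := by
  rcases hs.1.eq_or_lt with rfl | hs1
  · rw [hg1]; exact hG0 _ hs
  have hL : 1 < L := hs1.trans_le hs.2
  have hLm : L ∈ Icc 1 L := right_mem_Icc.2 hL.le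
  set D : ℝ := L - 1 with hDdef
  have hD : 0 < D := by linarith
  apply le_of_forall_pos_le_add
  intro ε hε
  -- The first `η` pays for the value near 1, the rest for the accumulated moduli of continuity. The
  -- other `ε / 2` is reserved for the quadratic error of the boundary step.
  obtain ⟨η, hη, hηε⟩ : ∃ η > 0, η + D * (η + 16 * D * η) ≤ ε / 2 := by
    refine ⟨ε / 2 / (1 + D * (1 + 16 * D)), by positivity, le_of_eq ?_⟩
    field_simp
  obtain ⟨δ₁, hδ₁, hm1⟩ := exists_dist_le_of_continuousOn hκ hη
  obtain ⟨δ₂, hδ₂, hm2⟩ := exists_dist_le_of_continuousOn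
    (fun s hs => (hg' s hs).continuousAt.continuousWithinAt : ContinuousOn g' (Icc 1 L)) hη
  obtain ⟨δ₃, hδ₃, hm3⟩ := exists_dist_le_of_continuousOn
    (fun s hs => (hg s hs).continuousAt.continuousWithinAt : ContinuousOn g (Icc 1 L)) hη
  have hκL := hκ0 L hLm
  obtain ⟨δ₄, hδ₄, hm4⟩ : ∃ δ₄ > 0, 8 * κ L * δ₄ * D ≤ ε / 2 := by
    refine ⟨ε / 2 / (8 * κ L * D + 1), by positivity, ?_⟩
    have : 8 * κ L * (ε / 2 / (8 * κ L * D + 1)) * D =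
      ε / 2 * ((8 * κ L * D) / (8 * κ L * D + 1)) := by ring
    rw [this]
    have : (8 * κ L * D) / (8 * κ L * D + 1) ≤ 1 := by
      rw [div_le_one (by positivity)]; linarith
    nlinarith
  set δ₀ := min (min δ₁ δ₂) (min δ₃ δ₄) with hδ₀
  have hδ₀pos : 0 < δ₀ := by positivity
  -- The nodes are counted downwards from `L`, and the mesh makes `s` a node. The point 1 need not
  -- be one; the last node `K` lies within `δ` of it.
  obtain ⟨δ, hδ, hδδ₀, j, hj⟩ : ∃ δ > 0, δ ≤ δ₀ ∧ ∃ j : ℕ, s = L - j * δ := by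
    rcases hs.2.eq_or_lt with h | h
    · exact ⟨δ₀, hδ₀pos, le_rfl, 0, by simp [h]⟩
    · obtain ⟨N, hN⟩ := exists_nat_gt ((L - s) / δ₀)
      have hLs : 0 < L - s := by linarith
      have hN0 : (0 : ℝ) < N := lt_trans (by positivity) hN
      refine ⟨(L - s) / N, by positivity, ?_, N, ?_⟩
      · rw [div_lt_iff₀ hδ₀pos] at hN
        rw [div_le_iff₀ hN0]
        linarith
      · field_simp; ring
  have hδ1 : δ ≤ δ₁ := hδδ₀.trans ((min_le_left _ _).trans (min_le_left _ _))
  have hδ2 : δ ≤ δ₂ := hδδ₀.trans ((min_le_left _ _).trans (min_le_right _ _))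
  have hδ3 : δ ≤ δ₃ := hδδ₀.trans ((min_le_right _ _).trans (min_le_left _ _))
  have hδ4 : δ ≤ δ₄ := hδδ₀.trans ((min_le_right _ _).trans (min_le_right _ _))
  set K : ℕ := ⌊D / δ⌋₊ with hK
  have hK1 : K * δ ≤ D := by
    rw [← le_div_iff₀ hδ]
    exact Nat.floor_le (by positivity)
  have hK2 : D < (K + 1) * δ := by
    rw [← div_lt_iff₀ hδ]
    exact Nat.lt_floor_add_one _
  have hjK : j ≤ K := by
    rw [hK, Nat.le_floor_iff (by positivity), le_div_iff₀ hδ]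
    linarith
  have hmem : ∀ k : ℕ, k ≤ K → L - k * δ ∈ Icc 1 L := by
    intro k hk
    have h1 : (k : ℝ) ≤ K := by exact_mod_cast hk
    have h2 : (k : ℝ) * δ ≤ K * δ := by gcongr
    have h3 : 0 ≤ (k : ℝ) * δ := by positivity
    constructor <;> linarith
  set e : ℕ → ℝ := fun k => g (L - k * δ) - G (L - k * δ) with he
  have h0 : 0 < K → e 0 ≤ e 1 + (η * δ + 8 * κ L * δ ^ 2) := by
    intro hK0
    have hmem1 := hmem 1 hK0
    simp only [he, Nat.cast_zero, Nat.cast_one, zero_mul, one_mul, sub_zero] at hmem1 ⊢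
    have h1 := hG1 δ hδ hmem1.1
    obtain ⟨ξ, hξ, hξ'⟩ := exists_hasDerivAt_eq_slope g g' (by linarith : L - δ < L)
      (fun y hy => (hg y ⟨by linarith [hy.1, hmem1.1], hy.2⟩).continuousAt.continuousWithinAt)
      (fun y hy => hg y ⟨by linarith [hy.1, hmem1.1], hy.2.le⟩)
    rw [sub_sub_cancel, eq_div_iff hδ.ne'] at hξ'
    have h2 := hm2 ξ ⟨by linarith [hξ.1, hmem1.1], hξ.2.le⟩ L hLm
      (by rw [abs_sub_comm, abs_of_nonneg (by linarith [hξ.2])]; linarith [hξ.1])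
    have h3 := mul_le_mul_of_nonneg_right (abs_le.1 h2).2 hδ.le
    rw [hgL] at h3
    linarith
  have h2 : ∀ k, k + 2 ≤ K → e (k + 1) ≤ (e k + e (k + 2)) / 2 + 8 * η * δ ^ 2 := by
    intro k hk
    set y : ℝ := L - (k + 1 : ℕ) * δ with hy
    have e1 : L - (k : ℕ) * δ = y + δ := by rw [hy]; push_cast; ring
    have e2 : L - (k + 2 : ℕ) * δ = y - δ := by rw [hy]; push_cast; ring
    have m0 := hmem (k + 1) (by omega)
    have m1 := hmem k (by omega)
    have m2 := hmem (k + 2) hk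
    simp only [he]
    rw [e1] at m1
    rw [e2] at m2
    rw [e1, e2, ← hy] at *
    have hsub : Icc (y - δ) (y + δ) ⊆ Icc 1 L := Icc_subset_Icc m2.1 m1.2
    -- On the cell around `y`, `κ ≤ κ y + η`, so this `c` is a lower bound for `g''`.
    have h3 := add_half_mul_sq_le_midpoint (c := -16 * (κ y + η)) hδ.le
      (fun x hx => hg x (hsub hx)) (fun x hx => hg' x (hsub hx)) (fun r hr => by
        have n1 := hm1 (y + r) (hsub ⟨by linarith [hr.1], by linarith [hr.2]⟩) y m0
          (by rw [add_sub_cancel_left, abs_of_nonneg hr.1]; linarith [hr.2])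
        have n2 := hm1 (y - r) (hsub ⟨by linarith [hr.2], by linarith [hr.1]⟩) y m0
          (by rw [sub_sub_cancel_left, abs_neg, abs_of_nonneg hr.1]; linarith [hr.2])
        linarith [(abs_le.1 n1).2, (abs_le.1 n2).2])
    have h4 := hG2 y δ hδ m2.1 m1.2
    linarith
  have hfin := le_of_almost_convex (by positivity : 0 ≤ 8 * η * δ ^ 2) (by positivity) h0 h2 hjK
  have hKm := hmem K le_rfl
  have heK : e K ≤ η := by
    have h3 := hm3 _ hKm 1 ⟨le_rfl, hL.le⟩
      (by rw [abs_of_nonneg (by linarith [hKm.1])]; linarith)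
    rw [hg1, sub_zero] at h3
    have := hG0 _ hKm
    simp only [he]
    linarith [(abs_le.1 h3).2]
  have hes : e j = g s - G s := by simp only [he, hj]
  rw [hes] at hfin
  have hbound : K * (η * δ + 8 * κ L * δ ^ 2 + 2 * K * (8 * η * δ ^ 2)) ≤
      D * (η + 16 * D * η) + ε / 2 := by
    have : K * (η * δ + 8 * κ L * δ ^ 2 + 2 * K * (8 * η * δ ^ 2)) =
        (K * δ) * (η + 16 * (K * δ) * η) + 8 * κ L * δ * (K * δ) := by ring
    rw [this]
    have h4 : 8 * κ L * δ * (K * δ) ≤ 8 * κ L * δ₄ * D := by gcongr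
    have h5 : (K * δ) * (η + 16 * (K * δ) * η) ≤ D * (η + 16 * D * η) := by gcongr
    linarith
  linarith

/-! ### From attained values to Bellman functions. -/

theorem Attains.le_of_mainInequality {Q : ℝ} {Φ g : ℝ → ℝ} (hΦ : ∀ u, 1 ≤ u → 0 ≤ Φ u)
    (hg : ∀ u ∈ Icc 1 Q, 0 ≤ g u) (h : MainInequality Q Φ g) {u c : ℝ} (hu : u ∈ Icc 1 Q)
    (hc : Attains Q Φ u c) : c ≤ g u := by
  have hu0 : 0 < u := by linarith [hu.1]
  obtain ⟨w, hw, hw'⟩ := hc.2 0 1 (u, 1) one_pos hu0 one_pos (mul_one u)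
  have := dyadicSum_le_of_mainInequality one_pos hw hΦ hg h
  rw [hw', mul_one, ENNReal.ofReal_le_ofReal_iff (hg u hu)] at this
  exact this

theorem le_upperBellman {Q a b : ℝ} (hab : a < b) {Φ : ℝ → ℝ} {x : ℝ × ℝ} (hx : x ∈ Omega Q)
    {r : ℝ} (h : ∀ ε > 0, ∃ c, r - ε ≤ c ∧ Attains Q Φ (x.1 * x.2) c) :
    ENNReal.ofReal r ≤ upperBellman Q Φ a b x := by
  apply ENNReal.le_of_forall_pos_le_add
  intro ε hε _
  obtain ⟨c, hc, hA⟩ := h ε (by exact_mod_cast hε)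
  obtain ⟨w, hw, hw'⟩ := hA.2 a b x hab hx.1 hx.2.1 rfl
  calc ENNReal.ofReal r ≤ ENNReal.ofReal (c + ε) := ENNReal.ofReal_le_ofReal (by linarith)
    _ = ENNReal.ofReal c + ε := by
      rw [ENNReal.ofReal_add hA.1 ε.coe_nonneg, ENNReal.ofReal_coe_nnreal]
    _ ≤ upperBellman Q Φ a b x + ε := by
      gcongr
      rw [← hw']
      exact le_iSup₂ (f := fun w _ => dyadicSum Φ a b w) w hw

theorem lowerBellman_le {Q a b : ℝ} (hab : a < b) {Φ : ℝ → ℝ} {x : ℝ × ℝ} (hx : x ∈ Omega Q)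
    {r : ℝ} (hr : 0 ≤ r) (h : ∀ ε > 0, ∃ c, c ≤ r + ε ∧ Attains Q Φ (x.1 * x.2) c) :
    lowerBellman Q Φ a b x ≤ ENNReal.ofReal r := by
  apply ENNReal.le_of_forall_pos_le_add
  intro ε hε _
  obtain ⟨c, hc, hA⟩ := h ε (by exact_mod_cast hε)
  obtain ⟨w, hw, hw'⟩ := hA.2 a b x hab hx.1 hx.2.1 rfl
  calc lowerBellman Q Φ a b x ≤ dyadicSum Φ a b w :=
        iInf₂_le (f := fun w _ => dyadicSum Φ a b w) w hw
    _ = ENNReal.ofReal c := hw'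
    _ ≤ ENNReal.ofReal (r + ε) := ENNReal.ofReal_le_ofReal hc
    _ = ENNReal.ofReal r + ε := by
      rw [ENNReal.ofReal_add hr ε.coe_nonneg, ENNReal.ofReal_coe_nnreal]

theorem upperBellman_eq {Q a b : ℝ} (hab : a < b) {Φ g : ℝ → ℝ} (hΦ : ∀ u, 1 ≤ u → 0 ≤ Φ u)
    (hg : ∀ u ∈ Icc 1 Q, 0 ≤ g u) (h : MainInequality Q Φ g) {x : ℝ × ℝ} (hx : x ∈ Omega Q)
    (hA : ∀ ε > 0, ∃ c, g (x.1 * x.2) - ε ≤ c ∧ Attains Q Φ (x.1 * x.2) c) :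
    upperBellman Q Φ a b x = ENNReal.ofReal (g (x.1 * x.2)) :=
  le_antisymm (iSup₂_le fun _ hw => dyadicSum_le_of_mainInequality hab hw hΦ hg h)
    (le_upperBellman hab hx hA)

/-- The upper Bellman function is minorized by the solution of the second-order problem. -/
theorem Attains.exists_near_of_second_order {Q L : ℝ} (hQL : L ^ 2 = Q) {Φ g g' : ℝ → ℝ} {C : ℝ}
    (hΦ : ∀ v, 1 ≤ v → 0 ≤ Φ v) (hC : ∀ u ∈ Icc 1 Q, ∀ c, Attains Q Φ u c → c ≤ C)
    (hg1 : g 1 = 0) (hg : ∀ s ∈ Icc 1 L, HasDerivAt g (g' s) s)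
    (hg' : ∀ s ∈ Icc 1 L, HasDerivAt g' (-16 * (Φ (s ^ 2) / s ^ 2)) s)
    (hκ : ContinuousOn (fun s => Φ (s ^ 2) / s ^ 2) (Icc 1 L))
    (hgL : g' L = 16 * L * (Φ (L ^ 2) / L ^ 2))
    {s : ℝ} (hs : s ∈ Icc 1 L) {ε : ℝ} (hε : 0 < ε) :
    ∃ c, g s - ε ≤ c ∧ Attains Q Φ (s ^ 2) c := by
  have hL : 1 ≤ L := hs.1.trans hs.2
  have hQ : 1 ≤ Q := by rw [← hQL]; nlinarith
  have hsq : ∀ t ∈ Icc 1 L, t ^ 2 ∈ Icc 1 Q := fun t ht => by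
    rw [← hQL]
    exact ⟨by nlinarith [ht.1], by nlinarith [ht.1, ht.2]⟩
  set A : ℝ → Set ℝ := fun t => {c | Attains Q Φ (t ^ 2) c} with hAdef
  have hne : ∀ t ∈ Icc 1 L, (A t).Nonempty := fun t ht =>
    ⟨_, (Attains.one hQ Φ).step one_pos (hsq t ht).1 (hsq t ht).2 (hΦ _ (hsq t ht).1)⟩
  have hbdd : ∀ t ∈ Icc 1 L, BddAbove (A t) := fun t ht => ⟨C, fun c hc => hC _ (hsq t ht) c hc⟩
  -- The supremum of attained values inherits the interior inequality from splittings with `t₁ = t₂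
  -- = δ / t` and the boundary inequality from `Attains.step` at `L`.
  have key : g s ≤ sSup (A s) := by
    refine le_of_second_order (G := fun t => sSup (A t)) hg1 hg hg' hκ ?_ hgL ?_ ?_ ?_ hs
    · intro t ht
      have := hΦ _ (hsq t ht).1
      positivity
    · intro t ht
      obtain ⟨c, hc⟩ := hne t ht
      exact hc.1.trans (le_csSup (hbdd t ht) hc)
    · intro t δ hδ h1 h2
      have ht : t ∈ Icc 1 L := ⟨by linarith, by linarith⟩
      have htp : t + δ ∈ Icc 1 L := ⟨by linarith, h2⟩
      have htm : t - δ ∈ Icc 1 L := ⟨h1, by linarith⟩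
      have ht0 : 0 < t := by linarith [ht.1]
      have habs : |δ / t| < 1 := by
        rw [abs_of_pos (by positivity), div_lt_one ht0]; linarith
      have hstep : ∀ c ∈ A (t + δ), ∀ d ∈ A (t - δ),
          (c + d) / 2 + 8 * (Φ (t ^ 2) / t ^ 2) * δ ^ 2 ≤ sSup (A t) := by
        intro c hc d hd
        have hc' : Attains Q Φ (t ^ 2 * ((1 + δ / t) * (1 + δ / t))) c := by
          rw [show t ^ 2 * ((1 + δ / t) * (1 + δ / t)) = (t + δ) ^ 2 by field_simp]
          exact hc
        have hd' : Attains Q Φ (t ^ 2 * ((1 - δ / t) * (1 - δ / t))) d := by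
          rw [show t ^ 2 * ((1 - δ / t) * (1 - δ / t)) = (t - δ) ^ 2 by field_simp]
          exact hd
        have := Attains.split (hsq t ht).2 (hΦ _ (hsq t ht).1) habs habs hc' hd'
        have h5 := le_csSup (hbdd t ht) this
        have h6 : 8 * (Φ (t ^ 2) / t ^ 2) * δ ^ 2 =
            4 * Φ (t ^ 2) * ((δ / t) ^ 2 + (δ / t) ^ 2) := by
          field_simp; ring
        rwa [h6]
      -- The two children vary independently, so the suprema are taken one after the other.
      have h3 : ∀ d ∈ A (t - δ), sSup (A (t + δ)) ≤
          2 * (sSup (A t) - 8 * (Φ (t ^ 2) / t ^ 2) * δ ^ 2) - d := fun d hd =>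
        csSup_le (hne _ htp) fun c hc => by linarith [hstep c hc d hd]
      have h4 : sSup (A (t - δ)) ≤
          2 * (sSup (A t) - 8 * (Φ (t ^ 2) / t ^ 2) * δ ^ 2) - sSup (A (t + δ)) :=
        csSup_le (hne _ htm) fun d hd => by linarith [h3 d hd]
      linarith
    · intro δ hδ h1
      have hm : L - δ ∈ Icc 1 L := ⟨h1, by linarith⟩
      have hLm : L ∈ Icc 1 L := ⟨hL, le_rfl⟩
      have : sSup (A (L - δ)) ≤
          sSup (A L) - 8 * (Φ (L ^ 2) / L ^ 2) * (L ^ 2 - (L - δ) ^ 2) :=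
        csSup_le (hne _ hm) fun c hc => by
          have := le_csSup (hbdd L hLm) (Attains.step (by linarith [(hsq _ hm).1])
            (by nlinarith) (hsq L hLm).2 (hΦ _ (hsq L hLm).1) hc)
          linarith
      linarith
  obtain ⟨c, hc, hc'⟩ := exists_lt_of_lt_csSup (hne s hs) (by linarith : g s - ε < sSup (A s))
  exact ⟨c, hc'.le, hc⟩

/-! ### The main inequality for the first-order solutions. -/

/-- Bernoulli's inequality for negative exponents. -/
theorem one_sub_mul_le_rpow_neg {x β : ℝ} (hx : x < 1) (hβ : 0 ≤ β) :
    1 + β * x ≤ (1 - x) ^ (-β) := by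
  rw [Real.rpow_def_of_pos (by linarith)]
  have h1 := Real.add_one_le_exp (Real.log (1 - x) * -β)
  have h2 := Real.log_le_sub_one_of_pos (by linarith : 0 < 1 - x)
  nlinarith

theorem two_mul_sqrt_mul_le {A B : ℝ} (hA : 0 ≤ A) (hB : 0 ≤ B) :
    2 * Real.sqrt (A * B) ≤ A + B := by
  rw [Real.sqrt_mul hA]
  nlinarith [sq_nonneg (Real.sqrt A - Real.sqrt B), Real.sq_sqrt hA, Real.sq_sqrt hB]

theorem factors_pos {t₁ t₂ : ℝ} (h1 : |t₁| < 1) (h2 : |t₂| < 1) :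
    0 < 1 + t₁ ∧ 0 < 1 - t₁ ∧ 0 < 1 + t₂ ∧ 0 < 1 - t₂ := by
  rw [abs_lt] at h1 h2
  refine ⟨?_, ?_, ?_, ?_⟩ <;> linarith

/-- The arithmetic-geometric mean inequality regroups the factors into `((1 - t₁²) (1 - t₂²)) ^ (α /
2)`, and Bernoulli's inequality bounds each factor. The first estimate is an equality for `t₂ =
-t₁`, the extremal splitting. -/
theorem mainInequality_rpow_neg (Q : ℝ) {α : ℝ} (hα : α < 0) :
    MainInequality Q (fun t => t ^ α) (fun u => 8 / α * (u ^ α - 1)) := by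
  intro u t₁ t₂ hu _ h1 h2 _ _
  obtain ⟨p1, p2, p3, p4⟩ := factors_pos h1 h2
  have hu0 : 0 < u := by linarith
  have huα : 0 < u ^ α := Real.rpow_pos_of_pos hu0 _
  have key : 2 * (1 - α / 2 * (t₁ ^ 2 + t₂ ^ 2)) ≤
      ((1 + t₁) * (1 + t₂)) ^ α + ((1 - t₁) * (1 - t₂)) ^ α := by
    have hA : 0 < ((1 + t₁) * (1 + t₂)) ^ α := by positivity
    have hB : 0 < ((1 - t₁) * (1 - t₂)) ^ α := by positivity
    refine le_trans ?_ (two_mul_sqrt_mul_le hA.le hB.le)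
    have q1 : t₁ ^ 2 < 1 := by rw [sq_lt_one_iff_abs_lt_one]; exact h1
    have q2 : t₂ ^ 2 < 1 := by rw [sq_lt_one_iff_abs_lt_one]; exact h2
    have e : Real.sqrt (((1 + t₁) * (1 + t₂)) ^ α * ((1 - t₁) * (1 - t₂)) ^ α) =
        (1 - t₁ ^ 2) ^ (-(-α / 2)) * (1 - t₂ ^ 2) ^ (-(-α / 2)) := by
      rw [← Real.mul_rpow (by positivity) (by positivity), Real.sqrt_eq_rpow,
        ← Real.rpow_mul (by positivity), ← Real.mul_rpow (by linarith) (by linarith)]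
      congr 1 <;> ring
    rw [e]
    have b1 := one_sub_mul_le_rpow_neg q1 (by linarith : 0 ≤ -α / 2)
    have b2 := one_sub_mul_le_rpow_neg q2 (by linarith : 0 ≤ -α / 2)
    have c1 : 0 ≤ -α / 2 * t₁ ^ 2 := by have : 0 ≤ -α / 2 := by linarith
                                        positivity
    have c2 : 0 ≤ -α / 2 * t₂ ^ 2 := by have : 0 ≤ -α / 2 := by linarith
                                        positivity
    have := mul_le_mul b1 b2 (by linarith) (by linarith)
    nlinarith [mul_nonneg c1 c2]
  simp only
  rw [Real.mul_rpow hu0.le (by positivity), Real.mul_rpow hu0.le (by positivity)]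
  have h3 := mul_le_mul_of_nonneg_left key (by have := neg_pos.2 hα; positivity :
    0 ≤ 4 / (-α) * u ^ α)
  rw [div_neg, neg_mul, neg_mul, neg_mul] at h3
  have hα0 := hα.ne
  have e1 : 4 / α * u ^ α * (2 * (1 - α / 2 * (t₁ ^ 2 + t₂ ^ 2))) =
      8 / α * u ^ α - 4 * u ^ α * (t₁ ^ 2 + t₂ ^ 2) := by
    field_simp; ring
  have e2 : 8 / α = 2 * (4 / α) := by ring
  rw [e1, e2] at h3
  rw [e2]
  linarith

/-- The logarithms of the children add up to those of `1 - t₁²` and `1 - t₂²`, and `log (1 - t²) ≤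
-t²`. -/
theorem mainInequality_log (Q : ℝ) :
    MainInequality Q (fun t => t ^ (0 : ℝ)) (fun u => 8 * Real.log u) := by
  intro u t₁ t₂ hu _ h1 h2 _ _
  obtain ⟨p1, p2, p3, p4⟩ := factors_pos h1 h2
  have hu0 : 0 < u := by linarith
  have q1 := Real.log_le_sub_one_of_pos (mul_pos p1 p2)
  have q2 := Real.log_le_sub_one_of_pos (mul_pos p3 p4)
  rw [Real.log_mul p1.ne' p2.ne'] at q1
  rw [Real.log_mul p3.ne' p4.ne'] at q2
  simp only [Real.rpow_zero]
  rw [Real.log_mul hu0.ne' (by positivity), Real.log_mul hu0.ne' (by positivity),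
    Real.log_mul p1.ne' p3.ne', Real.log_mul p2.ne' p4.ne']
  nlinarith

/-- The mean of the two products is `1 + t₁ t₂`; convexity of the power, Bernoulli's inequality and
`(t₁ + t₂)² ≥ 0` give the claim. -/
theorem mainInequality_neg_rpow (Q : ℝ) {α : ℝ} (hα : 1 ≤ α) :
    MainInequality Q (-fun t => t ^ α) (-fun u => 8 / α * (u ^ α - 1)) := by
  intro u t₁ t₂ hu _ h1 h2 _ _
  obtain ⟨p1, p2, p3, p4⟩ := factors_pos h1 h2
  have hu0 : 0 < u := by linarith
  have huα : 0 < u ^ α := Real.rpow_pos_of_pos hu0 _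
  have key : 2 * (1 + α * (t₁ * t₂)) ≤
      ((1 + t₁) * (1 + t₂)) ^ α + ((1 - t₁) * (1 - t₂)) ^ α := by
    have hconv := (convexOn_rpow hα).2 (x := (1 + t₁) * (1 + t₂)) (y := (1 - t₁) * (1 - t₂))
      (mem_Ici.2 (by positivity)) (mem_Ici.2 (by positivity)) (by norm_num : (0 : ℝ) ≤ 1 / 2)
      (by norm_num : (0 : ℝ) ≤ 1 / 2) (by norm_num)
    simp only [smul_eq_mul] at hconv
    have e : 1 / 2 * ((1 + t₁) * (1 + t₂)) + 1 / 2 * ((1 - t₁) * (1 - t₂)) = 1 + t₁ * t₂ := by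
      ring
    rw [e] at hconv
    have := one_add_mul_self_le_rpow_one_add (s := t₁ * t₂)
      (by nlinarith [mul_pos p1 p3, mul_pos p2 p4]) hα
    linarith
  have key2 : 2 * (1 - α / 2 * (t₁ ^ 2 + t₂ ^ 2)) ≤
      ((1 + t₁) * (1 + t₂)) ^ α + ((1 - t₁) * (1 - t₂)) ^ α := by
    nlinarith [mul_nonneg (by linarith : 0 ≤ α) (sq_nonneg (t₁ + t₂))]
  simp only [Pi.neg_apply]
  rw [Real.mul_rpow hu0.le (by positivity), Real.mul_rpow hu0.le (by positivity)]
  have hα0 : 0 < α := by linarith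
  have h3 := mul_le_mul_of_nonneg_left key2 (by positivity : 0 ≤ 4 / α * u ^ α)
  have e1 : 4 / α * u ^ α * (2 * (1 - α / 2 * (t₁ ^ 2 + t₂ ^ 2))) =
      8 / α * u ^ α - 4 * u ^ α * (t₁ ^ 2 + t₂ ^ 2) := by
    field_simp; ring
  have e2 : 8 / α = 2 * (4 / α) := by ring
  rw [e1, e2] at h3
  rw [e2]
  linarith

/-! ### The main inequality for the second-order solutions. -/

/-- The main inequality in the coordinates `√(x₁⁺ x₂⁺) = s (m + r)`, `√(x₁⁻ x₂⁻) = s (m - r)`. -/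
theorem mainInequality_of_sqrt {Q L : ℝ} (hL : L = Real.sqrt Q) {Φ h : ℝ → ℝ}
    (H : ∀ s m r : ℝ, 1 ≤ s → s ≤ L → 0 ≤ r → r < m → m ≤ 1 → s * (m + r) ≤ L →
      (h (s * (m + r)) + h (s * (m - r))) / 2 +
        8 * Φ (s ^ 2) * ((1 - m ^ 2) * (1 - r ^ 2) + m ^ 2 * r ^ 2) ≤ h s) :
    MainInequality Q Φ (fun u => h (Real.sqrt u)) := by
  have main : ∀ u t₁ t₂ : ℝ, 1 ≤ u → u ≤ Q → |t₁| < 1 → |t₂| < 1 →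
      u * ((1 + t₁) * (1 + t₂)) ≤ Q → (1 - t₁) * (1 - t₂) ≤ (1 + t₁) * (1 + t₂) →
      (h (Real.sqrt (u * ((1 + t₁) * (1 + t₂)))) + h (Real.sqrt (u * ((1 - t₁) * (1 - t₂))))) / 2 +
        4 * Φ u * (t₁ ^ 2 + t₂ ^ 2) ≤ h (Real.sqrt u) := by
    intro u t₁ t₂ hu huQ h1 h2 hQ hle
    obtain ⟨p1, p2, p3, p4⟩ := factors_pos h1 h2
    have hu0 : 0 < u := by linarith
    have hA : 0 < (1 + t₁) * (1 + t₂) := by positivity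
    have hB : 0 < (1 - t₁) * (1 - t₂) := by positivity
    have hsA := Real.sq_sqrt hA.le
    have hsB := Real.sq_sqrt hB.le
    have hbpos := Real.sqrt_pos.2 hB
    have hab := Real.sqrt_le_sqrt hle
    -- These two estimates give `A + B ≤ 2`, that is, `m ≤ 1`.
    have a2 := two_mul_sqrt_mul_le p1.le p3.le
    have b2 := two_mul_sqrt_mul_le p2.le p4.le
    have hQ' := Real.sqrt_le_sqrt hQ
    rw [Real.sqrt_mul hu0.le, Real.sqrt_mul hu0.le]
    rw [Real.sqrt_mul hu0.le, ← hL] at hQ'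
    set A := Real.sqrt ((1 + t₁) * (1 + t₂))
    set B := Real.sqrt ((1 - t₁) * (1 - t₂))
    have key := H (Real.sqrt u) ((A + B) / 2) ((A - B) / 2) (Real.one_le_sqrt.2 hu)
      (by rw [hL]; exact Real.sqrt_le_sqrt huQ) (by linarith) (by linarith) (by linarith)
      (by rwa [show (A + B) / 2 + (A - B) / 2 = A by ring])
    rw [show (A + B) / 2 + (A - B) / 2 = A by ring, show (A + B) / 2 - (A - B) / 2 = B by ring,
      Real.sq_sqrt hu0.le] at key
    have e : (1 - ((A + B) / 2) ^ 2) * (1 - ((A - B) / 2) ^ 2) +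
        ((A + B) / 2) ^ 2 * ((A - B) / 2) ^ 2 = (t₁ ^ 2 + t₂ ^ 2) / 2 := by
      have : (1 - ((A + B) / 2) ^ 2) * (1 - ((A - B) / 2) ^ 2) +
        ((A + B) / 2) ^ 2 * ((A - B) / 2) ^ 2 =
        1 - (A ^ 2 + B ^ 2) / 2 + (A ^ 2 - B ^ 2) ^ 2 / 8 := by ring
      rw [this, hsA, hsB]
      ring
    rw [e] at key
    linarith
  intro u t₁ t₂ hu huQ h1 h2 hp hm
  rcases le_total ((1 - t₁) * (1 - t₂)) ((1 + t₁) * (1 + t₂)) with hle | hle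
  · exact main u t₁ t₂ hu huQ h1 h2 hp.2 hle
  · have := main u (-t₁) (-t₂) hu huQ (by rwa [abs_neg]) (by rwa [abs_neg])
      (by simpa only [← sub_eq_add_neg] using hm.2)
      (by simpa only [← sub_eq_add_neg, sub_neg_eq_add] using hle)
    simp only [← sub_eq_add_neg, sub_neg_eq_add, neg_sq] at this
    simp only
    linarith

theorem two_mul_rpow_le_of_nonpos {m r q : ℝ} (hr : 0 ≤ r) (hrm : r < m) (hq : q ≤ 0) :
    2 * m ^ q ≤ (m + r) ^ q + (m - r) ^ q := by
  have h1 : 0 < m + r := by linarith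
  have h2 : 0 < m - r := by linarith
  have hm : 0 < m := by linarith
  refine le_trans ?_ (two_mul_sqrt_mul_le (Real.rpow_nonneg h1.le q) (Real.rpow_nonneg h2.le q))
  have e : m ^ q = Real.sqrt ((m * m) ^ q) := by
    rw [Real.mul_rpow hm.le hm.le, Real.sqrt_mul_self (by positivity)]
  rw [← Real.mul_rpow h1.le h2.le, e]
  gcongr 2 * Real.sqrt ?_
  exact Real.rpow_le_rpow_of_nonpos (by positivity) (by nlinarith) hq

theorem two_mul_rpow_le_of_one_le {m r q : ℝ} (hr : 0 ≤ r) (hrm : r < m) (hq : 1 ≤ q) :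
    2 * m ^ q ≤ (m + r) ^ q + (m - r) ^ q := by
  have h := (convexOn_rpow hq).2 (x := m + r) (y := m - r) (mem_Ici.2 (by linarith))
    (mem_Ici.2 (by linarith)) (by norm_num : (0 : ℝ) ≤ 1 / 2) (by norm_num : (0 : ℝ) ≤ 1 / 2)
    (by norm_num)
  simp only [smul_eq_mul] at h
  rw [show 1 / 2 * (m + r) + 1 / 2 * (m - r) = m by ring] at h
  linarith

theorem hasDerivAt_rpow_div {p x : ℝ} (hp0 : p ≠ 0) (hx : 0 < x) :
    HasDerivAt (fun x => x ^ p / (p * (p - 1))) (x ^ (p - 1) / (p - 1)) x := by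
  refine ((Real.hasDerivAt_rpow_const (Or.inl hx.ne')).div_const _).congr_deriv ?_
  field_simp

theorem hasDerivAt_rpow_sub_one_div {p x : ℝ} (hp1 : p ≠ 1) (hx : 0 < x) :
    HasDerivAt (fun x => x ^ (p - 1) / (p - 1)) (x ^ (p - 2)) x := by
  have : p - 1 ≠ 0 := sub_ne_zero.2 hp1
  refine ((Real.hasDerivAt_rpow_const (Or.inl hx.ne')).div_const _).congr_deriv ?_
  rw [show p - 1 - 1 = p - 2 by ring]
  field_simp

/-- The second derivative of `x ^ p / (p (p - 1))` is `x ^ (p - 2)`, convex exactly in the two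
stated ranges. With `p = 2α` the gap `2 < p < 3` is the range of `α` that has only an estimate. -/
theorem rpow_midpoint {p m r : ℝ} (hp0 : p ≠ 0) (hp1 : p ≠ 1) (hp : p ≤ 2 ∨ 3 ≤ p) (hr : 0 ≤ r)
    (hrm : r < m) :
    m ^ p / (p * (p - 1)) + m ^ (p - 2) * r ^ 2 / 2 ≤
      ((m + r) ^ p / (p * (p - 1)) + (m - r) ^ p / (p * (p - 1))) / 2 := by
  apply add_half_mul_sq_le_midpoint hr
    (fun x hx => hasDerivAt_rpow_div hp0 (by linarith [hx.1]))
    (fun x hx => hasDerivAt_rpow_sub_one_div hp1 (by linarith [hx.1]))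
  intro ρ hρ
  rcases hp with hp | hp
  · exact two_mul_rpow_le_of_nonpos hρ.1 (by linarith [hρ.2]) (by linarith)
  · exact two_mul_rpow_le_of_one_le hρ.1 (by linarith [hρ.2]) (by linarith)

/-- The case of jumps across the hyperbolas, for functions with steep enough slope. -/
theorem half_one_sub_sq_le {f f' : ℝ → ℝ} {c m : ℝ} (hm1 : m ≤ 1)
    (hf : ∀ x ∈ Icc m 1, HasDerivAt f (f' x) x) (hf' : ∀ x ∈ Icc m 1, f' x + x ≤ c) :
    (1 - m ^ 2) / 2 ≤ f m - f 1 + c * (1 - m) := by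
  have d : ∀ x ∈ Icc m 1, HasDerivAt (fun x => f x - c * x + x ^ 2 / 2) (f' x - c + x) x := by
    intro x hx
    have h2 := (hasDerivAt_pow 2 x).div_const 2
    refine (((hf x hx).sub ((hasDerivAt_id x).const_mul c)).add h2).congr_deriv ?_
    norm_num
  have : AntitoneOn (fun x => f x - c * x + x ^ 2 / 2) (Icc m 1) := by
    apply antitoneOn_of_hasDerivWithinAt_nonpos (convex_Icc m 1)
      (fun x hx => (d x hx).continuousAt.continuousWithinAt)
      (fun x hx => (d x (interior_subset hx)).hasDerivWithinAt)
    intro x hx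
    linarith [hf' x (interior_subset hx)]
  have := this (left_mem_Icc.2 hm1) (right_mem_Icc.2 hm1) hm1
  simp only at this
  linarith

/-- The left side is at most `(1 - m²) / 2 + r² / 2`. Midpoint convexity pays for the second term,
since `m ^ (p - 2) ≥ 1`, and the slope term pays for the first. -/
theorem core_le_two {p m r : ℝ} (hp0 : 0 < p) (hp1 : p ≠ 1) (hp2 : p ≤ 2) (hr : 0 ≤ r)
    (hrm : r < m) (hm1 : m ≤ 1) :
    ((1 - m ^ 2) * (1 - r ^ 2) + m ^ 2 * r ^ 2) / 2 ≤
      ((m + r) ^ p / (p * (p - 1)) + (m - r) ^ p / (p * (p - 1))) / 2 - 1 / (p * (p - 1)) +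
        p / (p - 1) * (1 - m) := by
  have hm : 0 < m := by linarith
  have h1 := rpow_midpoint hp0.ne' hp1 (Or.inl hp2) hr hrm
  have h2 := half_one_sub_sq_le (c := p / (p - 1)) hm1
    (fun x hx => hasDerivAt_rpow_div hp0.ne' (hm.trans_le hx.1)) (fun x hx => by
      have hx0 := hm.trans_le hx.1
      have : x ^ (p - 1) / (p - 1) + 1 ≤ p / (p - 1) := by
        rcases lt_or_gt_of_ne hp1 with h | h
        · have h3 : 1 ≤ x ^ (p - 1) :=
            Real.one_le_rpow_of_pos_of_le_one_of_nonpos hx0 hx.2 (by linarith)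
          rw [div_add_one (by linarith), div_le_div_right_of_neg (by linarith)]
          linarith
        · have h3 : x ^ (p - 1) ≤ 1 := Real.rpow_le_one hx0.le hx.2 (by linarith)
          rw [div_add_one (by linarith), div_le_div_iff_of_pos_right (by linarith)]
          linarith
      linarith [hx.2])
  rw [Real.one_rpow] at h2
  have h3 : 1 ≤ m ^ (p - 2) :=
    Real.one_le_rpow_of_pos_of_le_one_of_nonpos hm hm1 (by linarith)
  have h4 : m ^ 2 * r ^ 2 ≤ r ^ 2 :=
    mul_le_of_le_one_left (sq_nonneg r) (pow_le_one₀ hm.le hm1)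
  have h5 : r ^ 2 ≤ m ^ (p - 2) * r ^ 2 := by nlinarith [sq_nonneg r]
  linarith

theorem core_mul_log {m r : ℝ} (hr : 0 ≤ r) (hrm : r < m) (hm1 : m ≤ 1) :
    ((1 - m ^ 2) * (1 - r ^ 2) + m ^ 2 * r ^ 2) / 2 ≤
      ((m + r) * Real.log (m + r) + (m - r) * Real.log (m - r)) / 2 + 2 * (1 - m) := by
  have hm : 0 < m := by linarith
  have h1 := add_half_mul_sq_le_midpoint (f := fun x => x * Real.log x)
    (f' := fun x => Real.log x + 1) (f'' := fun x => x⁻¹) (c := m⁻¹) hr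
    (fun x hx => Real.hasDerivAt_mul_log (by linarith [hx.1]))
    (fun x hx => (Real.hasDerivAt_log (by linarith [hx.1])).add_const 1)
    (fun ρ hρ => by
      have := two_mul_rpow_le_of_nonpos (q := -1) hρ.1 (by linarith [hρ.2] : ρ < m) (by norm_num)
      simpa only [Real.rpow_neg_one] using this)
  have h2 := half_one_sub_sq_le (f := fun x => x * Real.log x) (f' := fun x => Real.log x + 1)
    (c := 2) hm1 (fun x hx => Real.hasDerivAt_mul_log (by linarith [hx.1])) (fun x hx => by
      have := Real.log_le_sub_one_of_pos (hm.trans_le hx.1)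
      linarith [hx.2])
  simp only [Real.log_one, mul_zero, sub_zero] at h1 h2
  have h3 : 1 ≤ m⁻¹ := (one_le_inv₀ hm).2 hm1
  have h4 : m ^ 2 * r ^ 2 ≤ r ^ 2 :=
    mul_le_of_le_one_left (sq_nonneg r) (pow_le_one₀ hm.le hm1)
  have h5 : r ^ 2 ≤ m⁻¹ * r ^ 2 := by nlinarith [sq_nonneg r]
  linarith

/-- Here `Y` and `T` stand for `m ^ (p - 2)` and `M ^ (p - 1)`, known through Bernoulli bounds. With
`ε = 1 - m`, the term `ε²` suffices for `r ≤ ε`; for `r > ε` the excess `T - 1 ≥ (p - 1) (r - ε)` is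
needed. -/
theorem core_three_le_algebra {p m r Y T : ℝ} (hp : 3 ≤ p) (hr : 0 ≤ r) (hrm : r < m)
    (hm1 : m ≤ 1) (hY0 : 0 ≤ Y) (hY : 1 - (p - 2) * (1 - m) ≤ Y) (hT1 : 1 ≤ T)
    (hT : 1 + (p - 1) * (m + r - 1) ≤ T) :
    (1 - m) * 2 + (2 * m ^ 2 - 1) * r ^ 2 ≤
      Y * r ^ 2 + 2 * (1 - m) * (1 - m) + 2 * p / (p - 1) * (T - 1) * (1 - m) +
        (2 - (1 - m)) * (1 - m) := by
  obtain ⟨ε, rfl⟩ : ∃ ε, m = 1 - ε := ⟨1 - m, by ring⟩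
  have hp1 : 0 < p - 1 := by linarith
  have hε : 0 ≤ ε := by linarith
  rw [sub_sub_cancel] at *
  have hr2 := sq_nonneg r
  suffices h : 0 ≤ ε ^ 2 + 2 * p / (p - 1) * (T - 1) * ε + (Y - (2 * (1 - ε) ^ 2 - 1)) * r ^ 2 by
    linarith
  have hY1 : -1 ≤ Y - (2 * (1 - ε) ^ 2 - 1) := by nlinarith
  rcases le_or_gt r ε with h | h
  · have h1 : 0 ≤ 2 * p / (p - 1) * (T - 1) * ε := by
      have : 0 ≤ T - 1 := by linarith
      positivity
    have h2 := mul_le_mul_of_nonneg_right hY1 hr2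
    nlinarith
  · have h1 : 2 * p * (r - ε) * ε ≤ 2 * p / (p - 1) * (T - 1) * ε := by
      have h2 : (p - 1) * (r - ε) ≤ T - 1 := by linarith
      calc 2 * p * (r - ε) * ε = 2 * p / (p - 1) * ((p - 1) * (r - ε)) * ε := by field_simp
        _ ≤ _ := by gcongr
    suffices h2 : 0 ≤ ε ^ 2 + 2 * p * (r - ε) * ε + (Y - (2 * (1 - ε) ^ 2 - 1)) * r ^ 2 by
      linarith
    -- For `2 p ε ≥ 1` the crude bound `-1` on the coefficient of `r²` is enough, as `r + ε < 1`.
    -- For smaller `ε` the Bernoulli bound on `Y` makes the loss proportional to `ε`.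
    rcases le_or_gt 1 (2 * p * ε) with hpε | hpε
    · have h2 := mul_le_mul_of_nonneg_right hY1 hr2
      have h3 : 0 ≤ (r - ε) * (2 * p * ε - r - ε) :=
        mul_nonneg (by linarith) (by linarith)
      linarith
    · have h2 : -(ε * (p - 6 + 2 * ε)) ≤ Y - (2 * (1 - ε) ^ 2 - 1) := by linarith
      have h3 := mul_le_mul_of_nonneg_right h2 hr2
      have h4 : (p - 6 + 2 * ε) * r ^ 2 ≤ ε + 2 * p * (r - ε) := by
        rcases le_or_gt (p - 6 + 2 * ε) 0 with hc | hc
        · have : (p - 6 + 2 * ε) * r ^ 2 ≤ 0 := mul_nonpos_of_nonpos_of_nonneg hc hr2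
          have : 0 ≤ 2 * p * (r - ε) := mul_nonneg (by linarith) (by linarith)
          linarith
        · have h5 : r ^ 2 ≤ ε ^ 2 + (r - ε) := by nlinarith
          have h6 : (p - 6 + 2 * ε) * r ^ 2 ≤ p * (ε ^ 2 + (r - ε)) :=
            mul_le_mul (by linarith) h5 hr2 (by linarith)
          have h7 : 0 ≤ p * (r - ε) := mul_nonneg (by linarith) (by linarith)
          nlinarith
      have h5 := mul_le_mul_of_nonneg_left h4 hε
      linarith

theorem core_three_le {p m r M : ℝ} (hp : 3 ≤ p) (hr : 0 ≤ r) (hrm : r < m) (hm1 : m ≤ 1)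
    (hM1 : 1 ≤ M) (hM : m + r ≤ M) :
    ((1 - m ^ 2) * (1 - r ^ 2) + m ^ 2 * r ^ 2) / 2 ≤
      ((m + r) ^ p / (p * (p - 1)) + (m - r) ^ p / (p * (p - 1))) / 2 - 1 / (p * (p - 1)) +
        p / (p - 1) * M ^ (p - 1) * (1 - m) := by
  have hm : 0 < m := by linarith
  have h1 := rpow_midpoint (by linarith) (by linarith) (Or.inr hp) hr hrm
  have hX := one_add_mul_self_le_rpow_one_add (s := m - 1) (by linarith) (p := p) (by linarith)
  have hY := one_add_mul_self_le_rpow_one_add (s := m - 1) (by linarith) (p := p - 2)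
    (by linarith)
  have hT := one_add_mul_self_le_rpow_one_add (s := M - 1) (by linarith) (p := p - 1)
    (by linarith)
  rw [add_sub_cancel] at hX hY hT
  have h2 := core_three_le_algebra (Y := m ^ (p - 2)) (T := M ^ (p - 1)) hp hr hrm hm1
    (by positivity) (by linarith) (Real.one_le_rpow hM1 (by linarith)) (by nlinarith)
  have hp0 : 0 < p := by linarith
  have hp1 : 0 < p - 1 := by linarith
  have h3 : (1 + p * (m - 1)) / (p * (p - 1)) ≤ m ^ p / (p * (p - 1)) := by gcongr
  have h4 : (1 + p * (m - 1)) / (p * (p - 1)) =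
      1 / (p * (p - 1)) + p / (p - 1) * (m - 1) + (1 - m) := by
    field_simp
    ring
  have h5 : 2 * p / (p - 1) * (M ^ (p - 1) - 1) * (1 - m) =
      2 * (p / (p - 1) * M ^ (p - 1) * (1 - m)) + 2 * (p / (p - 1) * (m - 1)) := by ring
  rw [h5] at h2
  linarith

/-! ### The upper Bellman functions for positive exponents. -/

theorem nonneg_of_second_order {L : ℝ} {g g' κ : ℝ → ℝ} (hg1 : g 1 = 0)
    (hg : ∀ s ∈ Icc 1 L, HasDerivAt g (g' s) s)
    (hg' : ∀ s ∈ Icc 1 L, HasDerivAt g' (-16 * κ s) s)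
    (hκ0 : ∀ s ∈ Icc 1 L, 0 ≤ κ s) (hgL : 0 ≤ g' L) {s : ℝ} (hs : s ∈ Icc 1 L) : 0 ≤ g s := by
  have hL : 1 ≤ L := hs.1.trans hs.2
  have anti : AntitoneOn g' (Icc 1 L) := by
    apply antitoneOn_of_hasDerivWithinAt_nonpos (convex_Icc 1 L)
      (fun x hx => (hg' x hx).continuousAt.continuousWithinAt)
      (fun x hx => (hg' x (interior_subset hx)).hasDerivWithinAt)
    intro x hx
    linarith [hκ0 x (interior_subset hx)]
  have mono : MonotoneOn g (Icc 1 L) := by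
    apply monotoneOn_of_hasDerivWithinAt_nonneg (convex_Icc 1 L)
      (fun x hx => (hg x hx).continuousAt.continuousWithinAt)
      (fun x hx => (hg x (interior_subset hx)).hasDerivWithinAt)
    intro x hx
    have hx := interior_subset hx
    exact hgL.trans (anti hx (right_mem_Icc.2 hL) hx.2)
  rw [← hg1]
  exact mono (left_mem_Icc.2 hL) hs hs.1

theorem mul_mem_Icc_of_mem_Omega {Q : ℝ} {x : ℝ × ℝ} (hx : x ∈ Omega Q) :
    x.1 * x.2 ∈ Icc 1 Q := ⟨hx.2.2.1, hx.2.2.2⟩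

theorem sqrt_mem_Icc {Q L u : ℝ} (hL : L = Real.sqrt Q) (hu : u ∈ Icc 1 Q) :
    Real.sqrt u ∈ Icc 1 L :=
  ⟨Real.one_le_sqrt.2 hu.1, hL ▸ Real.sqrt_le_sqrt hu.2⟩

/-- The differential problem gives minorization and nonnegativity; the main inequality gives
majorization, and also the finiteness of the supremum of attained values. -/
theorem upperBellman_eq_of_second_order {Q L a b : ℝ} (hL : L = Real.sqrt Q) (hab : a < b)
    {Φ g g' κ : ℝ → ℝ} (hΦ : ∀ v, 1 ≤ v → 0 ≤ Φ v) (hg1 : g 1 = 0)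
    (hg : ∀ s ∈ Icc 1 L, HasDerivAt g (g' s) s)
    (hg' : ∀ s ∈ Icc 1 L, HasDerivAt g' (-16 * κ s) s) (hκ : ContinuousOn κ (Icc 1 L))
    (hΦκ : ∀ s ∈ Icc 1 L, Φ (s ^ 2) / s ^ 2 = κ s) (hgL : g' L = 16 * L * κ L)
    (h : MainInequality Q Φ fun u => g (Real.sqrt u)) {x : ℝ × ℝ} (hx : x ∈ Omega Q) :
    0 ≤ g (Real.sqrt (x.1 * x.2)) ∧
      upperBellman Q Φ a b x = ENNReal.ofReal (g (Real.sqrt (x.1 * x.2))) := by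
  have hu := mul_mem_Icc_of_mem_Omega hx
  have hQ : 1 ≤ Q := hu.1.trans hu.2
  have hL1 : 1 ≤ L := by rw [hL]; exact Real.one_le_sqrt.2 hQ
  have hLm : L ∈ Icc 1 L := ⟨hL1, le_rfl⟩
  have hQL : L ^ 2 = Q := by rw [hL]; exact Real.sq_sqrt (by linarith)
  have hκ0 : ∀ s ∈ Icc 1 L, 0 ≤ κ s := fun s hs => by
    rw [← hΦκ s hs]
    have := hΦ (s ^ 2) (by nlinarith [hs.1])
    positivity
  have hκL := hκ0 L hLm
  have hgL0 : 0 ≤ g' L := by rw [hgL]; positivity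
  have hmono : ∀ s ∈ Icc 1 L, 0 ≤ g s := fun s hs =>
    nonneg_of_second_order hg1 hg hg' hκ0 hgL0 hs
  have hgu : ∀ u ∈ Icc 1 Q, 0 ≤ g (Real.sqrt u) := fun u hu => hmono _ (sqrt_mem_Icc hL hu)
  obtain ⟨C, hC⟩ := isCompact_Icc.bddAbove_image
    (fun s hs => (hg s hs).continuousAt.continuousWithinAt : ContinuousOn g (Icc 1 L))
  refine ⟨hgu _ hu, upperBellman_eq (g := fun u => g (Real.sqrt u)) hab hΦ hgu h hx ?_⟩
  intro ε hε
  have key := Attains.exists_near_of_second_order (C := C) hQL hΦ (fun u hu c hc =>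
      (hc.le_of_mainInequality hΦ hgu h hu).trans
        (hC (mem_image_of_mem g (sqrt_mem_Icc hL hu)))) hg1 hg
    (fun s hs => by rw [hΦκ s hs]; exact hg' s hs) (hκ.congr hΦκ)
    (by rw [hΦκ L hLm]; exact hgL) (sqrt_mem_Icc hL hu) hε
  rwa [Real.sq_sqrt (by linarith [hu.1])] at key

theorem sq_rpow {α s : ℝ} (hs : 0 ≤ s) : (s ^ 2) ^ α = s ^ (2 * α) := by
  rw [← Real.rpow_natCast, ← Real.rpow_mul hs, Nat.cast_ofNat]

theorem rpow_div_sq {α s : ℝ} (hs : 0 < s) : (s ^ 2) ^ α / s ^ 2 = s ^ (2 * α - 2) := by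
  rw [sq_rpow hs.le, Real.rpow_sub hs, Real.rpow_two]

theorem rpow_eq_rpow_sub_one_mul {p s : ℝ} (hs : 0 < s) : s ^ p = s ^ (p - 1) * s := by
  rw [← Real.rpow_add_one hs.ne', sub_add_cancel]

theorem rpow_nonneg_of_one_le (α : ℝ) : ∀ u : ℝ, 1 ≤ u → 0 ≤ u ^ α := fun _ hu =>
  Real.rpow_nonneg (by linarith) α

/-- The candidate for the upper Bellman function of a power weight, as a function of `√(x₁ x₂)`. -/
noncomputable def candidate (L p s : ℝ) : ℝ :=
  16 / (p * (p - 1)) * (1 - s ^ p) + 16 * p / (p - 1) * L ^ (p - 1) * (s - 1)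

theorem candidate_step {L p s m r T : ℝ} (hs : 0 < s) (hr : 0 ≤ r)
    (hrm : r < m) (hm1 : m ≤ 1) (hT : s ^ p * T ≤ p / (p - 1) * L ^ (p - 1) * s)
    (h : ((1 - m ^ 2) * (1 - r ^ 2) + m ^ 2 * r ^ 2) / 2 ≤
      ((m + r) ^ p / (p * (p - 1)) + (m - r) ^ p / (p * (p - 1))) / 2 - 1 / (p * (p - 1)) +
        T * (1 - m)) :
    (candidate L p (s * (m + r)) + candidate L p (s * (m - r))) / 2 +
      8 * s ^ p * ((1 - m ^ 2) * (1 - r ^ 2) + m ^ 2 * r ^ 2) ≤ candidate L p s := by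
  have hsp : 0 < s ^ p := Real.rpow_pos_of_pos hs p
  have h1 := mul_le_mul_of_nonneg_left h (by positivity : 0 ≤ 16 * s ^ p)
  have h2 := mul_le_mul_of_nonneg_right hT (by linarith : 0 ≤ 1 - m)
  unfold candidate
  rw [Real.mul_rpow hs.le (by linarith), Real.mul_rpow hs.le (by linarith)]
  set D := 1 / (p * (p - 1)) with hD
  have e1 : (m + r) ^ p / (p * (p - 1)) = D * (m + r) ^ p := by rw [hD]; ring
  have e2 : (m - r) ^ p / (p * (p - 1)) = D * (m - r) ^ p := by rw [hD]; ring
  have e3 : 16 / (p * (p - 1)) = 16 * D := by rw [hD]; ring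
  have e4 : 16 * p / (p - 1) = 16 * (p / (p - 1)) := by ring
  rw [e1, e2] at h1
  rw [e3, e4]
  linarith

theorem mainInequality_candidate {Q L α : ℝ} (hL : L = Real.sqrt Q) (hα : 0 < α)
    (hα2 : α ≠ 1 / 2) (hα3 : α ≤ 1 ∨ 3 / 2 ≤ α) :
    MainInequality Q (fun t => t ^ α) (fun u => candidate L (2 * α) (Real.sqrt u)) := by
  apply mainInequality_of_sqrt hL
  intro s m r hs hsL hr hrm hm1 hle
  have hs0 : 0 < s := by linarith
  have hp1 : 2 * α ≠ 1 := fun h => hα2 (by linarith)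
  simp only [sq_rpow hs0.le]
  rcases hα3 with h | h
  · refine candidate_step (T := 2 * α / (2 * α - 1)) hs0 hr hrm hm1 ?_
      (core_le_two (by linarith) hp1 (by linarith) hr hrm hm1)
    rw [rpow_eq_rpow_sub_one_mul hs0]
    have key : 2 * α / (2 * α - 1) * s ^ (2 * α - 1) ≤ 2 * α / (2 * α - 1) * L ^ (2 * α - 1) := by
      rcases lt_or_gt_of_ne hp1 with h' | h'
      · apply mul_le_mul_of_nonpos_left
        · exact Real.rpow_le_rpow_of_nonpos hs0 hsL (by linarith)
        · exact div_nonpos_of_nonneg_of_nonpos (by linarith) (by linarith)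
      · apply mul_le_mul_of_nonneg_left
        · exact Real.rpow_le_rpow hs0.le hsL (by linarith)
        · exact div_nonneg (by linarith) (by linarith)
    have := mul_le_mul_of_nonneg_right key hs0.le
    linarith
  · have hp : 0 ≤ 2 * α / (2 * α - 1) := div_nonneg (by linarith) (by linarith)
    -- Both `s` and `s (m + r)` are at most `L`, so `s M ≤ L`. For `p ≥ 3` the proof exploits that
    -- the larger child stays in the domain.
    set M := max 1 (m + r)
    have hM1 : 1 ≤ M := le_max_left _ _
    have hsM : s * M ≤ L := by
      rw [mul_max_of_nonneg _ _ hs0.le, mul_one]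
      exact max_le hsL hle
    refine candidate_step (T := 2 * α / (2 * α - 1) * M ^ (2 * α - 1)) hs0 hr hrm hm1 ?_
      (core_three_le (by linarith) hr hrm hm1 hM1 (le_max_right _ _))
    rw [rpow_eq_rpow_sub_one_mul hs0]
    have h1 : s ^ (2 * α - 1) * M ^ (2 * α - 1) ≤ L ^ (2 * α - 1) := by
      rw [← Real.mul_rpow hs0.le (by linarith)]
      exact Real.rpow_le_rpow (by positivity) hsM (by linarith)
    have := mul_le_mul_of_nonneg_left h1 (mul_nonneg hp hs0.le)
    linarith

theorem continuousOn_rpow_const (q B : ℝ) : ContinuousOn (fun s : ℝ => s ^ q) (Icc 1 B) :=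
  fun s hs => (Real.continuousAt_rpow_const s q
    (Or.inl (by linarith [hs.1] : 0 < s).ne')).continuousWithinAt

theorem upperBellmanPow_eq_candidate {Q L a b α : ℝ} (hL : L = Real.sqrt Q) (hab : a < b)
    (hα : 0 < α) (hα2 : α ≠ 1 / 2) (hα3 : α ≤ 1 ∨ 3 / 2 ≤ α) {x : ℝ × ℝ} (hx : x ∈ Omega Q) :
    0 ≤ candidate L (2 * α) (Real.sqrt (x.1 * x.2)) ∧ upperBellmanPow Q α a b x =
      ENNReal.ofReal (candidate L (2 * α) (Real.sqrt (x.1 * x.2))) := by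
  have hp0 : 2 * α ≠ 0 := by positivity
  have hp1 : 2 * α ≠ 1 := fun h => hα2 (by linarith)
  have hp1' : 2 * α - 1 ≠ 0 := sub_ne_zero.2 hp1
  have hL1 : 1 ≤ L := by
    rw [hL]
    exact Real.one_le_sqrt.2 (hx.2.2.1.trans hx.2.2.2)
  have hL0 : 0 < L := by linarith
  refine upperBellman_eq_of_second_order (κ := fun s => s ^ (2 * α - 2))
    (g' := fun s => -16 * (s ^ (2 * α - 1) / (2 * α - 1)) +
      16 * (2 * α) / (2 * α - 1) * L ^ (2 * α - 1)) hL hab (rpow_nonneg_of_one_le α) ?_ ?_ ?_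
    (continuousOn_rpow_const _ _) ?_ ?_ (mainInequality_candidate hL hα hα2 hα3) hx
  · simp [candidate]
  · intro s hs
    have hs0 : 0 < s := by linarith [hs.1]
    have h1 := (hasDerivAt_rpow_div hp0 hs0).const_mul (-16)
    have h2 := ((hasDerivAt_id s).sub_const 1).const_mul
      (16 * (2 * α) / (2 * α - 1) * L ^ (2 * α - 1))
    rw [mul_one] at h2
    refine ((h1.add h2).const_add (16 / (2 * α * (2 * α - 1)))).congr_of_eventuallyEq
      (Eventually.of_forall fun y => ?_)
    simp only [candidate, Pi.add_apply, id]
    ring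
  · intro s hs
    exact ((hasDerivAt_rpow_sub_one_div hp1 (by linarith [hs.1])).const_mul (-16)).add_const _
  · intro s hs
    exact rpow_div_sq (by linarith [hs.1])
  · have : L ^ (2 * α - 1) = L * L ^ (2 * α - 2) := by
      rw [mul_comm L, ← Real.rpow_add_one hL0.ne']
      congr 1; ring
    simp only [this]
    field_simp
    ring

/-- The limit case `p = 1` of the candidate. -/
noncomputable def logCandidate (L s : ℝ) : ℝ :=
  32 * (s - 1) - 16 * Real.log L + 16 * s * Real.log (L / s)

theorem mainInequality_logCandidate {Q L : ℝ} (hL : L = Real.sqrt Q) :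
    MainInequality Q (fun t => t ^ (1 / 2 : ℝ)) (fun u => logCandidate L (Real.sqrt u)) := by
  apply mainInequality_of_sqrt hL
  intro s m r hs hsL hr hrm hm1 _
  have hs0 : 0 < s := by linarith
  have hL0 : 0 < L := by linarith
  have ha : 0 < m + r := by linarith
  have hb : 0 < m - r := by linarith
  have hlog := Real.log_le_log hs0 hsL
  have key := mul_le_mul_of_nonneg_left (core_mul_log hr hrm hm1) (by positivity : 0 ≤ 16 * s)
  have h2 : 0 ≤ s * (1 - m) * (Real.log L - Real.log s) :=
    mul_nonneg (mul_nonneg hs0.le (by linarith)) (by linarith)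
  simp only [sq_rpow hs0.le, logCandidate]
  norm_num only [Real.rpow_one]
  rw [Real.log_div hL0.ne' (by positivity), Real.log_div hL0.ne' (by positivity),
    Real.log_div hL0.ne' hs0.ne', Real.log_mul hs0.ne' ha.ne', Real.log_mul hs0.ne' hb.ne']
  linarith

theorem upperBellmanPow_half {Q L a b : ℝ} (hL : L = Real.sqrt Q) (hab : a < b)
    {x : ℝ × ℝ} (hx : x ∈ Omega Q) :
    0 ≤ logCandidate L (Real.sqrt (x.1 * x.2)) ∧ upperBellmanPow Q (1 / 2) a b x =
      ENNReal.ofReal (logCandidate L (Real.sqrt (x.1 * x.2))) := by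
  have hL1 : 1 ≤ L := by
    rw [hL]
    exact Real.one_le_sqrt.2 (hx.2.2.1.trans hx.2.2.2)
  have hL0 : 0 < L := by linarith
  refine upperBellman_eq_of_second_order (κ := fun s => s⁻¹)
    (g' := fun s => 16 + 16 * (Real.log L - Real.log s)) hL hab (rpow_nonneg_of_one_le _) ?_ ?_ ?_
    ?_ ?_ ?_ (mainInequality_logCandidate hL) hx
  · simp [logCandidate]
  · intro s hs
    have hs0 : 0 < s := by linarith [hs.1]
    have h1 := ((hasDerivAt_id s).sub_const 1).const_mul 32
    have h2 := ((hasDerivAt_id s).const_mul 16).mul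
      ((Real.hasDerivAt_log hs0.ne').const_sub (Real.log L))
    refine (((h1.sub_const (16 * Real.log L)).add h2).congr_of_eventuallyEq ?_).congr_deriv ?_
    · filter_upwards [lt_mem_nhds hs0] with y hy
      simp [logCandidate, Real.log_div hL0.ne' hy.ne']
    · simp only [id]
      field_simp
      ring
  · intro s hs
    have hs0 : 0 < s := by linarith [hs.1]
    refine (((Real.hasDerivAt_log hs0.ne').const_sub (Real.log L)).const_mul 16).const_add 16
      |>.congr_deriv ?_
    ring
  · exact continuousOn_id.inv₀ fun s hs => (by linarith [hs.1] : 0 < s).ne'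
  · intro s hs
    have hs0 : 0 < s := by linarith [hs.1]
    rw [rpow_div_sq hs0, ← Real.rpow_neg_one]
    norm_num
  · simp only [sub_self]
    field_simp
    ring

/-! ### Exponents with first-order extremals. -/

theorem rpow_div_self {v α : ℝ} (hv : 0 < v) : v ^ α / v = v ^ (α - 1) := by
  rw [Real.rpow_sub_one hv.ne']

/-- The solution `8 / α * (u ^ α - 1)` of the first-order equation is approximated. -/
theorem exists_attains_near_rpow {Q α : ℝ} (hα : α ≠ 0) {u : ℝ} (hu : u ∈ Icc 1 Q) {ε : ℝ}
    (hε : 0 < ε) :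
    ∃ c, |c - 8 / α * (u ^ α - 1)| ≤ ε ∧ Attains Q (fun t => t ^ α) u c := by
  refine Attains.exists_near (F := fun u => 8 / α * (u ^ α - 1)) (hu.1.trans hu.2)
    (rpow_nonneg_of_one_le α) ?_ ?_ (by simp) hu hε
  · refine ((continuousOn_rpow_const (α - 1) Q).const_smul (8 : ℝ)).congr fun v hv => ?_
    simp only [rpow_div_self (by linarith [hv.1] : 0 < v), smul_eq_mul, Pi.smul_apply]
  · intro v hv
    have hv0 : 0 < v := by linarith [hv.1]
    refine (((Real.hasDerivAt_rpow_const (p := α) (Or.inl hv0.ne')).sub_const 1).const_mul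
      (8 / α)).congr_deriv ?_
    simp only [rpow_div_self hv0]
    field_simp

theorem exists_attains_near_log {Q : ℝ} {u : ℝ} (hu : u ∈ Icc 1 Q) {ε : ℝ} (hε : 0 < ε) :
    ∃ c, |c - 8 * Real.log u| ≤ ε ∧ Attains Q (fun t => t ^ (0 : ℝ)) u c := by
  refine Attains.exists_near (F := fun u => 8 * Real.log u) (hu.1.trans hu.2)
    (rpow_nonneg_of_one_le 0) ?_ ?_ (by simp) hu hε
  · simp only [Real.rpow_zero, one_div]
    exact continuousOn_const.mul
      (continuousOn_id.inv₀ fun s hs => (by linarith [hs.1] : 0 < s).ne')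
  · intro v hv
    simp only [Real.rpow_zero, one_div]
    exact (Real.hasDerivAt_log (by linarith [hv.1] : 0 < v).ne').const_mul 8

theorem div_mul_rpow_sub_one_nonneg {α u : ℝ} (hu : 1 ≤ u) : 0 ≤ 8 / α * (u ^ α - 1) := by
  rcases le_or_gt 0 α with h | h
  · exact mul_nonneg (by positivity) (sub_nonneg.2 (Real.one_le_rpow hu h))
  · exact mul_nonneg_of_nonpos_of_nonpos (div_nonpos_of_nonneg_of_nonpos (by norm_num) h.le)
      (sub_nonpos.2 (Real.rpow_le_one_of_one_le_of_nonpos hu h.le))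

theorem upperBellmanPow_of_neg {Q a b α : ℝ} (hab : a < b) (hα : α < 0) {x : ℝ × ℝ}
    (hx : x ∈ Omega Q) :
    upperBellmanPow Q α a b x = ENNReal.ofReal (8 / α * ((x.1 * x.2) ^ α - 1)) := by
  refine upperBellman_eq (g := fun u => 8 / α * (u ^ α - 1)) hab (rpow_nonneg_of_one_le α)
    (fun u hu => div_mul_rpow_sub_one_nonneg hu.1) (mainInequality_rpow_neg Q hα) hx ?_
  intro ε hε
  obtain ⟨c, hc, hA⟩ := exists_attains_near_rpow hα.ne (mul_mem_Icc_of_mem_Omega hx) hε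
  exact ⟨c, by linarith [(abs_le.1 hc).1], hA⟩

theorem upperBellmanPow_zero {Q a b : ℝ} (hab : a < b) {x : ℝ × ℝ} (hx : x ∈ Omega Q) :
    upperBellmanPow Q 0 a b x = ENNReal.ofReal (8 * Real.log (x.1 * x.2)) := by
  refine upperBellman_eq (g := fun u => 8 * Real.log u) hab (rpow_nonneg_of_one_le 0)
    (fun u hu => by have := Real.log_nonneg hu.1; positivity) (mainInequality_log Q) hx ?_
  intro ε hε
  obtain ⟨c, hc, hA⟩ := exists_attains_near_log (mul_mem_Icc_of_mem_Omega hx) hε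
  exact ⟨c, by linarith [(abs_le.1 hc).1], hA⟩

theorem le_dyadicSum_rpow {Q a b α : ℝ} (hab : a < b) (hα : 1 ≤ α) {x : ℝ × ℝ} {w : ℝ → ℝ}
    (hw : w ∈ weights Q a b x) :
    ENNReal.ofReal (8 / α * ((x.1 * x.2) ^ α - 1)) ≤ dyadicSum (fun t => t ^ α) a b w := by
  have hα0 : 0 < α := by linarith
  refine le_dyadicSum_of_mainInequality (g := fun u => 8 / α * (u ^ α - 1))
    (C := 8 / α * (Q ^ α - 1)) hab hw ?_ (by simp) ?_ (mainInequality_neg_rpow Q hα)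
  · exact ((Real.continuousAt_rpow_const 1 α (Or.inl one_ne_zero)).sub
      continuousAt_const).const_mul _
  · intro u hu
    rw [abs_of_nonneg (div_mul_rpow_sub_one_nonneg hu.1)]
    have := Real.rpow_le_rpow (by linarith [hu.1]) hu.2 hα0.le
    gcongr

theorem lowerBellmanPow_of_one_le {Q a b α : ℝ} (hab : a < b) (hα : 1 ≤ α) {x : ℝ × ℝ}
    (hx : x ∈ Omega Q) :
    lowerBellmanPow Q α a b x = ENNReal.ofReal (8 / α * ((x.1 * x.2) ^ α - 1)) := by
  apply le_antisymm
  · apply lowerBellman_le hab hx (div_mul_rpow_sub_one_nonneg hx.2.2.1)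
    intro ε hε
    obtain ⟨c, hc, hA⟩ := exists_attains_near_rpow (by linarith : 0 < α).ne'
      (mul_mem_Icc_of_mem_Omega hx) hε
    exact ⟨c, by linarith [(abs_le.1 hc).2], hA⟩
  · exact le_iInf₂ fun w hw => le_dyadicSum_rpow hab hα hw

/-! ### The lower Bellman function on the upper boundary. -/

/-- The bracket in the coefficients of the dyadic sum. -/
theorem coeff_eq (a b : ℝ) (n k : ℕ) (w : ℝ → ℝ) :
    ∃ d, 0 ≤ d ∧ ∀ Φ : ℝ → ℝ, coeff Φ a b n k w = Φ (avgProd a b n k w) * d := by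
  refine ⟨volume.real (dyadic a b n k) * ((delta a b n k w) ^ 2 / (avg a b n k w) ^ 2 +
      (delta a b n k w⁻¹) ^ 2 / (avg a b n k w⁻¹) ^ 2), by positivity, fun Φ => ?_⟩
  rw [coeff, avgProd]
  ring

theorem mul_dyadicSum_le {Q a b C : ℝ} (hab : a < b) {w : ℝ → ℝ} (hw : MemA2 Q a b w)
    {Φ Ψ : ℝ → ℝ} (hC : 0 ≤ C) (h : ∀ u ∈ Icc 1 Q, C * Φ u ≤ Ψ u) :
    ENNReal.ofReal C * dyadicSum Φ a b w ≤ dyadicSum Ψ a b w := by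
  unfold dyadicSum
  rw [mul_left_comm, ← ENNReal.tsum_mul_left]
  gcongr with n
  rw [Finset.mul_sum]
  apply Finset.sum_le_sum
  intro k hk
  rw [← ENNReal.ofReal_mul hC]
  apply ENNReal.ofReal_le_ofReal
  obtain ⟨d, hd, e⟩ := coeff_eq a b n k w
  rw [e, e, ← mul_assoc]
  exact mul_le_mul_of_nonneg_right (h _ (hw.avgProd_mem hab (Finset.mem_range.1 hk))) hd

theorem lowerBellmanPow_boundary {Q a b α : ℝ} (hQ : 1 ≤ Q) (hab : a < b) (hα : α < 1)
    {x : ℝ × ℝ} (hx : x ∈ Omega Q) (hxQ : x.1 * x.2 = Q) :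
    lowerBellmanPow Q α a b x = ENNReal.ofReal (8 * Q ^ (α - 1) * (Q - 1)) := by
  have hQ0 : 0 < Q := by linarith
  have hQα : 0 ≤ Q ^ (α - 1) := by positivity
  have hQ1 : 0 ≤ Q - 1 := by linarith
  apply le_antisymm
  · apply lowerBellman_le hab hx (by positivity)
    intro ε hε
    -- A single splitting from the hyperbola `u = Q` to `u = 1`: the weight is constant on each
    -- half, and all of the sum sits at the top level.
    have h := (Attains.one hQ (fun t => t ^ α)).step one_pos hQ le_rfl
      (rpow_nonneg_of_one_le α Q hQ)
    refine ⟨_, ?_, by rw [hxQ]; exact h⟩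
    rw [rpow_div_self hQ0]
    linarith
  · refine le_iInf₂ fun w hw => ?_
    -- The lower bound for exponent 1 transfers through `Q ^ (α - 1) u ≤ u ^ α` on `[1, Q]`.
    have h1 := le_dyadicSum_rpow hab (le_refl (1 : ℝ)) hw
    have h2 := mul_dyadicSum_le (Φ := fun t => t ^ (1 : ℝ)) (Ψ := fun t => t ^ α) hab hw.1 hQα
      (fun u hu => by
        have hu0 : 0 < u := by linarith [hu.1]
        have := Real.rpow_le_rpow_of_nonpos hu0 hu.2 (by linarith : α - 1 ≤ 0)
        simp only [Real.rpow_one]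
        rw [rpow_eq_rpow_sub_one_mul (p := α) hu0]
        gcongr)
    refine le_trans ?_ h2
    refine le_trans (le_of_eq ?_) (mul_le_mul_right h1 _)
    rw [← ENNReal.ofReal_mul hQα, hxQ, Real.rpow_one]
    congr 1
    ring

/-! ### Interpolation between exponents. -/

/-- Hölder's inequality for dyadic sums with power functions. -/
theorem dyadicSum_rpow_le_mul {Q a b α β γ θ : ℝ} (hab : a < b) {w : ℝ → ℝ} (hw : MemA2 Q a b w)
    (hθ0 : 0 < θ) (hθ1 : θ < 1) (hα : α = β * θ + γ * (1 - θ)) :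
    dyadicSum (fun t => t ^ α) a b w ≤
      dyadicSum (fun t => t ^ β) a b w ^ θ * dyadicSum (fun t => t ^ γ) a b w ^ (1 - θ) := by
  have hθ2 : 0 < 1 - θ := by linarith
  set V := (volume (Ico a b))⁻¹ with hV
  have hV0 : V = V ^ θ * V ^ (1 - θ) := by
    rw [← ENNReal.rpow_add_of_nonneg _ _ hθ0.le hθ2.le, add_sub_cancel, ENNReal.rpow_one]
  -- The exponent enters a coefficient only through `u ^ α`, so the coefficients interpolate
  -- exactly, term by term.
  have hterm : ∀ n k, k < 2 ^ n → ENNReal.ofReal (coeff (fun t => t ^ α) a b n k w) =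
      ENNReal.ofReal (coeff (fun t => t ^ β) a b n k w) ^ θ *
        ENNReal.ofReal (coeff (fun t => t ^ γ) a b n k w) ^ (1 - θ) := by
    intro n k hk
    obtain ⟨d, hd, e⟩ := coeff_eq a b n k w
    have hu : 0 < avgProd a b n k w := by linarith [(hw.avgProd_mem hab hk).1]
    simp only [e]
    rw [ENNReal.ofReal_rpow_of_nonneg (by positivity) hθ0.le,
      ENNReal.ofReal_rpow_of_nonneg (by positivity) hθ2.le, ← ENNReal.ofReal_mul (by positivity)]
    congr 1
    rw [Real.mul_rpow (by positivity) hd, Real.mul_rpow (by positivity) hd, mul_mul_mul_comm,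
      ← Real.rpow_add_of_nonneg hd hθ0.le hθ2.le, ← Real.rpow_mul hu.le, ← Real.rpow_mul hu.le,
      ← Real.rpow_add hu, add_sub_cancel, Real.rpow_one, hα]
  have key : ∑' n : ℕ, ∑ k ∈ Finset.range (2 ^ n),
        ENNReal.ofReal (coeff (fun t => t ^ α) a b n k w) ≤
      (∑' n : ℕ, ∑ k ∈ Finset.range (2 ^ n),
        ENNReal.ofReal (coeff (fun t => t ^ β) a b n k w)) ^ θ *
      (∑' n : ℕ, ∑ k ∈ Finset.range (2 ^ n),
        ENNReal.ofReal (coeff (fun t => t ^ γ) a b n k w)) ^ (1 - θ) := by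
    rw [ENNReal.tsum_eq_iSup_nat]
    apply iSup_le
    intro N
    have h1 : ∀ f : ℕ → ℕ → ℝ≥0∞, ∑ n ∈ Finset.range N, ∑ k ∈ Finset.range (2 ^ n), f n k =
        ∑ i ∈ (Finset.range N).sigma fun n => Finset.range (2 ^ n), f i.1 i.2 := fun f =>
      Finset.sum_sigma' _ _ _
    have hpq : (θ⁻¹).HolderConjugate (1 - θ)⁻¹ := by
      rw [Real.holderConjugate_iff]
      refine ⟨(one_lt_inv₀ hθ0).2 hθ1, ?_⟩
      simp
    have h2 := ENNReal.inner_le_Lp_mul_Lq ((Finset.range N).sigma fun n => Finset.range (2 ^ n))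
      (fun i => ENNReal.ofReal (coeff (fun t => t ^ β) a b i.1 i.2 w) ^ θ)
      (fun i => ENNReal.ofReal (coeff (fun t => t ^ γ) a b i.1 i.2 w) ^ (1 - θ)) hpq
    simp only [← ENNReal.rpow_mul, mul_inv_cancel₀ hθ0.ne', mul_inv_cancel₀ hθ2.ne',
      ENNReal.rpow_one, one_div, inv_inv] at h2
    rw [h1]
    have h3 : ∀ i ∈ (Finset.range N).sigma fun n => Finset.range (2 ^ n),
        ENNReal.ofReal (coeff (fun t => t ^ α) a b i.1 i.2 w) =
          ENNReal.ofReal (coeff (fun t => t ^ β) a b i.1 i.2 w) ^ θ *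
            ENNReal.ofReal (coeff (fun t => t ^ γ) a b i.1 i.2 w) ^ (1 - θ) := fun i hi =>
      hterm _ _ (Finset.mem_range.1 (Finset.mem_sigma.1 hi).2)
    rw [Finset.sum_congr rfl h3]
    refine h2.trans ?_
    rw [← h1 fun n k => ENNReal.ofReal (coeff (fun t => t ^ β) a b n k w),
      ← h1 fun n k => ENNReal.ofReal (coeff (fun t => t ^ γ) a b n k w)]
    gcongr <;> exact ENNReal.sum_le_tsum _
  unfold dyadicSum
  rw [ENNReal.mul_rpow_of_nonneg _ _ hθ0.le, ENNReal.mul_rpow_of_nonneg _ _ hθ2.le,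
    mul_mul_mul_comm, ← hV0]
  gcongr

theorem upperBellmanPow_le_mul {Q a b α β γ θ : ℝ} (hab : a < b) (x : ℝ × ℝ)
    (hθ0 : 0 < θ) (hθ1 : θ < 1) (hα : α = β * θ + γ * (1 - θ)) :
    upperBellmanPow Q α a b x ≤
      upperBellmanPow Q β a b x ^ θ * upperBellmanPow Q γ a b x ^ (1 - θ) := by
  refine iSup₂_le fun w hw => (dyadicSum_rpow_le_mul hab hw.1 hθ0 hθ1 hα).trans ?_
  have hθ2 : 0 < 1 - θ := by linarith
  apply mul_le_mul'
  · exact ENNReal.rpow_le_rpow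
      (le_iSup₂ (f := fun w _ => dyadicSum (fun t => t ^ β) a b w) w hw) hθ0.le
  · exact ENNReal.rpow_le_rpow
      (le_iSup₂ (f := fun w _ => dyadicSum (fun t => t ^ γ) a b w) w hw) hθ2.le

/-! ### Assembly of the cases. -/

/-- `ENNReal.ofReal` truncates negative numbers to zero, so nonnegativity of each formula is needed
for a genuine equality of extended reals. -/
theorem coe_eq_of_eq_ofReal {X : ℝ≥0∞} {r : ℝ} (hr : 0 ≤ r) (h : X = ENNReal.ofReal r) :
    (X : EReal) = (r : EReal) := by
  rw [h, EReal.coe_ennreal_ofReal, max_eq_left hr]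

end CarlesonBellman

theorem corollary2p13 (Q : ℝ) (hQ : 1 ≤ Q) (a b : ℝ) (hab : a < b) (α : ℝ)
    (x : ℝ × ℝ) (hx : x ∈ CarlesonBellman.Omega Q)
    (L s : ℝ) (hL : L = Real.sqrt Q) (hs : s = Real.sqrt (x.1 * x.2)) :
    (((0 < α ∧ α < 1 / 2) ∨ (1 / 2 < α ∧ α ≤ 1) ∨ 3 / 2 ≤ α →
      ((CarlesonBellman.upperBellmanPow Q α a b x : ℝ≥0∞) : EReal) =
        ((8 / (α * (2 * α - 1)) * (1 - s ^ (2 * α)) +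
          32 * α / (2 * α - 1) * L ^ (2 * α - 1) * (s - 1) : ℝ) : EReal)) ∧
    (α = 1 / 2 →
      ((CarlesonBellman.upperBellmanPow Q α a b x : ℝ≥0∞) : EReal) =
        ((32 * (s - 1) - 16 * Real.log L + 16 * s * Real.log (L / s) : ℝ) : EReal)) ∧
    (α = 0 →
      ((CarlesonBellman.upperBellmanPow Q α a b x : ℝ≥0∞) : EReal) =
        ((16 * Real.log s : ℝ) : EReal)) ∧
    (α < 0 →
      ((CarlesonBellman.upperBellmanPow Q α a b x : ℝ≥0∞) : EReal) =
        ((8 / α * (s ^ (2 * α) - 1) : ℝ) : EReal)) ∧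
    (1 < α ∧ α < 3 / 2 →
      CarlesonBellman.upperBellmanPow Q α a b x ≤
        CarlesonBellman.upperBellmanPow Q 1 a b x ^ (3 - 2 * α) *
          CarlesonBellman.upperBellmanPow Q (3 / 2) a b x ^ (2 * α - 2))) ∧
    ((1 ≤ α →
      ((CarlesonBellman.lowerBellmanPow Q α a b x : ℝ≥0∞) : EReal) =
        ((8 / α * (s ^ (2 * α) - 1) : ℝ) : EReal)) ∧
    (α < 1 →
      ((CarlesonBellman.lowerBellmanPow Q α a b (x.1, Q / x.1) : ℝ≥0∞) : EReal) =
        ((8 * L ^ (2 * α - 2) * (L ^ 2 - 1) : ℝ) : EReal))) := by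
  open CarlesonBellman in
  have hu1 : 1 ≤ x.1 * x.2 := hx.2.2.1
  have hsq : s ^ 2 = x.1 * x.2 := by rw [hs]; exact Real.sq_sqrt (by linarith)
  have hLQ : L ^ 2 = Q := by rw [hL]; exact Real.sq_sqrt (by linarith)
  have hs0 : 0 ≤ s := by rw [hs]; exact Real.sqrt_nonneg _
  have hL1 : 1 ≤ L := by rw [hL]; exact Real.one_le_sqrt.2 hQ
  have hspow : (x.1 * x.2) ^ α = s ^ (2 * α) := by rw [← hsq, sq_rpow hs0]
  refine ⟨⟨?_, ?_, ?_, ?_, ?_⟩, ?_, ?_⟩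
  · intro h
    have h0 : 0 < α := by rcases h with h | h | h <;> linarith
    have h2 : α ≠ 1 / 2 := by rcases h with h | h | h <;> intro h' <;> linarith
    have h3 : α ≤ 1 ∨ 3 / 2 ≤ α := by
      rcases h with h | h | h
      · exact Or.inl (by linarith)
      · exact Or.inl h.2
      · exact Or.inr h
    obtain ⟨hn, he⟩ := upperBellmanPow_eq_candidate hL hab h0 h2 h3 hx
    rw [coe_eq_of_eq_ofReal hn he, ← hs, candidate]
    congr 2
    · rw [show 2 * α * (2 * α - 1) = 2 * (α * (2 * α - 1)) by ring, ← div_div]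
      norm_num
    · ring
  · rintro rfl
    obtain ⟨hn, he⟩ := upperBellmanPow_half hL hab hx
    rw [coe_eq_of_eq_ofReal hn he, ← hs, logCandidate]
  · rintro rfl
    have := Real.log_nonneg hu1
    rw [coe_eq_of_eq_ofReal (by positivity) (upperBellmanPow_zero hab hx), ← hsq, Real.log_pow]
    congr 1
    push_cast
    ring
  · intro h
    rw [coe_eq_of_eq_ofReal (div_mul_rpow_sub_one_nonneg hu1) (upperBellmanPow_of_neg hab h hx),
      hspow]
  · rintro ⟨h1, h2⟩
    -- The weight `θ` solves `α = θ + (3 / 2) (1 - θ)`.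
    have := upperBellmanPow_le_mul (Q := Q) (α := α) (β := 1) (γ := 3 / 2) (θ := 3 - 2 * α) hab x
      (by linarith) (by linarith) (by ring)
    rwa [show 1 - (3 - 2 * α) = 2 * α - 2 by ring] at this
  · intro h
    rw [coe_eq_of_eq_ofReal (div_mul_rpow_sub_one_nonneg hu1) (lowerBellmanPow_of_one_le hab h hx),
      hspow]
  · intro h
    have hxQ : x.1 * (Q / x.1) = Q := mul_div_cancel₀ Q hx.1.ne'
    have hx' : (x.1, Q / x.1) ∈ Omega Q :=
      ⟨hx.1, div_pos (by linarith) hx.1, by simpa only [hxQ] using hQ, hxQ.le⟩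
    have hQpow : Q ^ (α - 1) = L ^ (2 * α - 2) := by
      rw [← hLQ, sq_rpow (by linarith)]
      congr 1; ring
    have hnn : 0 ≤ 8 * Q ^ (α - 1) * (Q - 1) := by
      have : 0 ≤ Q - 1 := by linarith
      positivity
    rw [coe_eq_of_eq_ofReal hnn (lowerBellmanPow_boundary hQ hab h hx' hxQ), hQpow, hLQ]
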